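/- **Setting.** Let $d,n,m\ge 1$, let $\mathcal Y=\{-1,1\}^d$, $\bar d=d(d-1)/2$, and for $y\in\mathcal Y$ let $J(y)=(y(r)y(s))_{r<s}\in\mathbb R^{\bar d}$. For $\theta\in\mathbb R^{\bar d}$ put $C(\theta)=\sum_{y\in\mathcal Y}\exp(\theta'J(y))$ and $p(y|\theta)=\exp(\theta'J(y))/C(\theta)$ (Ising model). Let $Y_1,\dots,Y_n$ be independent with density $p(\cdot|\theta^*)$, where $\theta^*\in\mathbb R^{\bar d}$; let $T=\{(r,s):r<s,\ \theta^*_{rs}\neq 0\}$ be the edge set, $\bar d_0=|T|$ and $\theta^*_{\min}=\min_{(r,s)\in T}|\theta^*_{rs}|$ ($=+\infty$ if $T=\emptyset$). Let $\psi\in\mathbb R^{\bar d}$, $h=p(\cdot|\psi)$, and let $Y^1,\dots,Y^m$ be a Markov chain on $\mathcal Y$ with initial density $q$ (the density of $Y^1$), whose transitions are those of the random scan Gibbs sampler for $h$: a coordinate $r\in\{1,\dots,d\}$ is drawn uniformly, the spin at $r$ is set to $1$ with probability $\frac{\exp(\psi'J(y^+))}{\exp(\psi'J(y^+))+\exp(\psi'J(y^-))}$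 and to $-1$ otherwise, where $y^{\pm}$ is the current state with the spin at $r$ replaced by $\pm1$. With $P$ the transition matrix and $\kappa=\sup\{|\rho|:\rho\in\mathrm{Spec}(P)\setminus\{1\}\}$, put $$\beta_1=\sqrt{\sum_{y}\frac{q^2(y)}{h(y)}},\qquad \beta_2=\frac{1-\kappa}{1+\kappa},\qquad M=\max_{y}\frac{\exp((\theta^*)'J(y))}{h(y)C(\theta^*)}.$$ For $\xi>1$ let $\alpha(\xi)=2+\frac{e}{\xi-1}$, $\mathcal C(\xi,T)=\{\theta:|\theta_{T^c}|_1\le\xi|\theta_T|_1\}$, and $$F=\inf_{0\ne\theta\in\mathcal C(\xi,T)}\frac{\theta'\,\nabla^2\log C(\theta^*)\,\theta}{|\theta_T|_1\,|\theta|_\infty}$$ ($=+\infty$ if $T=\emptyset$). For $\varepsilon>0$ let $$\lambda=\frac{\xi+1}{\xi-1}\max\left(2\sqrt{\frac{2\log(2\bar d/\varepsilon)}{n}},\ 8M\sqrt{\frac{\log[(2\bar d+1)\beta_1/\varepsilon]}{m\beta_2}}\right),\qquad R=\frac{2e\,\xi\,\alpha(\xi)\,\lambda}{(\xi+1)[\alpha(\xi)-2]F}.$$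 Let the Lasso estimator $\hat\theta$ be a minimizer over $\theta\in\mathbb R^{\bar d}$ of $$-\frac1n\sum_{i=1}^n\theta'J(Y_i)+\log\left(\frac1m\sum_{k=1}^m\frac{\exp(\theta'J(Y^k))}{h(Y^k)}\right)+\lambda\sum_{r<s}|\theta_{rs}|$$ whenever a minimizer exists (and arbitrary otherwise), and for $\delta>0$ let $\hat T=\{(r,s):r<s,\ |\hat\theta_{rs}|>\delta\}$. **Claim.** Let $\varepsilon>0$, $\xi>1$, $\delta>0$. If $$n\ge\frac{8(1+\xi)^4\alpha^2(\xi)\,\bar d_0^2\log(2\bar d/\varepsilon)}{F^2},\qquad m\ge\frac{64(1+\xi)^4\alpha^2(\xi)\,\bar d_0^2M^2\log[2\bar d(\bar d+1)\beta_1/\varepsilon]}{F^2\beta_2},$$ and $\theta^*_{\min}/2>\delta\ge R$, then $$P(\hat T=T)\ge 1-4\varepsilon .$$ -/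

import Mathlib

open MeasureTheory ProbabilityTheory
open scoped ENNReal

noncomputable section

namespace IsingLasso

/-- Spin configurations `y ∈ {-1, 1}^d`; the group `ℤˣ` of units of `ℤ` is the set `{-1, 1}`. -/
abbrev Config (d : ℕ) : Type := Fin d → ℤˣ

/-- Every subset of the finite space `{-1, 1}` is measurable. -/
instance : MeasurableSingletonClass ℤˣ :=
  ⟨fun u => ⟨{(u : ℤ)}, measurableSet_singleton _, by ext v; simp [Units.ext_iff]⟩⟩

/-- Index pairs `(r, s)` with `r < s`. -/
abbrev Pair (d : ℕ) : Type := {p : Fin d × Fin d // p.1 < p.2}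

/-- Parameter vectors `θ = (θ_rs)_{r<s}`; the norm `‖θ‖` on this type is the maximum norm. -/
abbrev Param (d : ℕ) : Type := Pair d → ℝ

/-- The number `d (d - 1) / 2` of parameters. -/
def numParam (d : ℕ) : ℝ := (d : ℝ) * ((d : ℝ) - 1) / 2

/-- The vector `J(y) = (y(r) y(s))_{r<s}`. -/
def J {d : ℕ} (y : Config d) : Param d :=
  fun p => ((y p.1.1 : ℤ) : ℝ) * ((y p.1.2 : ℤ) : ℝ)

/-- The norming constant `C(θ) = ∑_y exp (θ' J(y))`. -/
def normConst {d : ℕ} (θ : Param d) : ℝ :=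
  ∑ y : Config d, Real.exp (θ ⬝ᵥ J y)

/-- The Ising density `p(y | θ) = exp (θ' J(y)) / C(θ)`. -/
def isingDensity {d : ℕ} (θ : Param d) (y : Config d) : ℝ :=
  Real.exp (θ ⬝ᵥ J y) / normConst θ

/-- The transition matrix of the random scan Gibbs sampler with parameter `ψ`: a coordinate `r` is
drawn uniformly, and the spin at `r` is replaced by `s ∈ {-1, 1}`, drawn with probability
`exp (ψ' J(y^s)) / (exp (ψ' J(y^+)) + exp (ψ' J(y^-)))`, where `y^s` is `y` with spin `s` at `r`. -/
def gibbsMatrix {d : ℕ} (ψ : Param d) : Matrix (Config d) (Config d) ℝ :=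
  Matrix.of fun y y' => (1 / (d : ℝ)) * ∑ r : Fin d, ∑ s : ℤˣ,
    if y' = Function.update y r s then
      Real.exp (ψ ⬝ᵥ J (Function.update y r s)) /
        (Real.exp (ψ ⬝ᵥ J (Function.update y r 1)) +
          Real.exp (ψ ⬝ᵥ J (Function.update y r (-1))))
    else 0

/-- `Z 0, …, Z (m - 1)` are the first `m` states of a Markov chain on the finite set `S` with initial
density `q` and transition matrix `P`. -/
structure IsMarkovChain {Ω S : Type*} [MeasurableSpace Ω] [MeasurableSpace S] (μ : Measure Ω)
    (q : S → ℝ) (P : Matrix S S ℝ) (m : ℕ) (Z : ℕ → Ω → S) : Prop where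
  measurable : ∀ k < m, Measurable (Z k)
  path_prob : ∀ N < m, ∀ z : ℕ → S,
    μ.real {ω | ∀ k ≤ N, Z k ω = z k} = q (z 0) * ∏ k ∈ Finset.range N, P (z k) (z (k + 1))

/-- `κ = sup {|ρ| : ρ ∈ Spec(P) \ {1}}`, so that `1 - κ` is the spectral gap. -/
def kappa {S : Type*} [Fintype S] [DecidableEq S] (P : Matrix S S ℝ) : ℝ :=
  sSup {x : ℝ | ∃ ρ ∈ spectrum ℝ P \ {1}, x = |ρ|}

/-- `β₁ = (∑_y q(y)² / h(y))^{1/2}`. -/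
def beta1 {d : ℕ} (q h : Config d → ℝ) : ℝ := √(∑ y, q y ^ 2 / h y)

/-- `β₂ = (1 - κ) / (1 + κ)` for the Gibbs sampler with parameter `ψ`. -/
def beta2 {d : ℕ} (ψ : Param d) : ℝ :=
  (1 - kappa (gibbsMatrix ψ)) / (1 + kappa (gibbsMatrix ψ))

/-- `M = max_y exp (θ' J(y)) / (h(y) C(θ))`. -/
def maxRatio {d : ℕ} (θ : Param d) (h : Config d → ℝ) : ℝ :=
  Finset.univ.sup' Finset.univ_nonempty
    fun y : Config d => Real.exp (θ ⬝ᵥ J y) / (h y * normConst θ)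

open Classical in
/-- The set of nonzero coordinates (edges) of `θ`. -/
def supp {d : ℕ} (θ : Param d) : Finset (Pair d) := {p | θ p ≠ 0}

open Classical in
/-- The set of coordinates that survive thresholding at level `δ`. -/
def thresholdSupp {d : ℕ} (δ : ℝ) (θ : Param d) : Finset (Pair d) := {p | δ < |θ p|}

/-- The smallest absolute value of a nonzero coordinate (`+∞` if there is none). -/
def thetaMin {d : ℕ} (θ : Param d) : ℝ≥0∞ := ⨅ p ∈ supp θ, ENNReal.ofReal |θ p|

/-- The `ℓ₁` norm of the restriction of `θ` to `A`. -/
def l1On {d : ℕ} (A : Finset (Pair d)) (θ : Param d) : ℝ := ∑ p ∈ A, |θ p|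

/-- The cone `{θ : |θ_{T^c}|₁ ≤ ξ |θ_T|₁}`. -/
def cone {d : ℕ} (ξ : ℝ) (T : Finset (Pair d)) : Set (Param d) :=
  {θ | l1On Tᶜ θ ≤ ξ * l1On T θ}

/-- The cone invertibility factor of a nonnegative definite matrix `A`,
`inf {θ' A θ / (|θ_T|₁ |θ|_∞) : 0 ≠ θ ∈ cone ξ T}`, with the infimum over the empty set
equal to `+∞` (this happens only for `T = ∅`). -/
def coneFactor {d : ℕ} (ξ : ℝ) (T : Finset (Pair d)) (A : Matrix (Pair d) (Pair d) ℝ) : ℝ≥0∞ :=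
  ⨅ θ ∈ {θ : Param d | θ ≠ 0 ∧ θ ∈ cone ξ T},
    ENNReal.ofReal ((θ ⬝ᵥ (A.mulVec θ)) / (l1On T θ * ‖θ‖))

/-- The Hessian matrix of second order partial derivatives of `f` at `x`. -/
def hessian {ι : Type*} [Fintype ι] [DecidableEq ι] (f : (ι → ℝ) → ℝ) (x : ι → ℝ) :
    Matrix ι ι ℝ :=
  Matrix.of fun i j =>
    fderiv ℝ (fun x' => fderiv ℝ f x' (Pi.single j 1)) x (Pi.single i 1)

/-- `F = F(ξ, T, ∇² log C(θ))` with `T` the set of nonzero coordinates of `θ`. -/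
def trueFactor {d : ℕ} (ξ : ℝ) (θ : Param d) : ℝ≥0∞ :=
  coneFactor ξ (supp θ) (hessian (fun θ' => Real.log (normConst θ')) θ)

/-- The Monte Carlo approximation of the negative log-likelihood,
`-(1/n) ∑ θ' J(Y_i) + log ((1/m) ∑ exp (θ' J(Y^k)) / h(Y^k))`, for data `y` and chain `z`
(the state `Y^k` of the chain is `z (k - 1)`). -/
def mcNegLogLik {d n : ℕ} (m : ℕ) (h : Config d → ℝ) (y : Fin n → Config d) (z : ℕ → Config d)
    (θ : Param d) : ℝ :=
  -(1 / (n : ℝ)) * ∑ i, θ ⬝ᵥ J (y i) +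
    Real.log ((1 / (m : ℝ)) * ∑ k ∈ Finset.range m, Real.exp (θ ⬝ᵥ J (z k)) / h (z k))

/-- The Lasso objective: the Monte Carlo approximation plus `lam |θ|₁`. -/
def lassoObjective {d n : ℕ} (m : ℕ) (h : Config d → ℝ) (lam : ℝ) (y : Fin n → Config d)
    (z : ℕ → Config d) (θ : Param d) : ℝ :=
  mcNegLogLik m h y z θ + lam * ∑ p, |θ p|

/-- `α(ξ) = 2 + e / (ξ - 1)`. -/
def alpha (ξ : ℝ) : ℝ := 2 + Real.exp 1 / (ξ - 1)

/-- The smoothing parameter `λ`, as a function of `d, n, m, ξ, ε, β₁, β₂, M`. -/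
def smoothing (d n m : ℕ) (ξ ε b1 b2 M : ℝ) : ℝ :=
  (ξ + 1) / (ξ - 1) *
    max (2 * √(2 * Real.log (2 * numParam d / ε) / n))
      (8 * M * √(Real.log ((2 * numParam d + 1) * b1 / ε) / (m * b2)))

/-- The bound `R = 2 e ξ α(ξ) λ / ((ξ + 1) (α(ξ) - 2) F)`. -/
def errorBound (ξ lam : ℝ) (F : ℝ≥0∞) : ℝ≥0∞ :=
  ENNReal.ofReal (2 * Real.exp 1 * ξ * alpha ξ * lam / ((ξ + 1) * (alpha ξ - 2))) / F

end IsingLasso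

end

open IsingLasso

-- Both log C(θ) and its Monte Carlo surrogate are log-partition functions of finite exponential
-- families (`logPartition`): the first has unit weights on all configurations, the second has
-- importance weights on the m states of the chain. Gradients are means, Hessians are covariances,
-- and one deterministic Lasso analysis applies to the random objective.
--
-- Deterministic part. Let Δ be the estimation error and T the true support. If the gradient of the
-- Monte Carlo loss at the truth is at most (ξ-1)/(ξ+1)·λ in maximum norm, convexity forces Δ into
-- the cone and bounds the increment of the directional derivative along Δ from above
-- (`tiltedMean_sub_le_of_isMinOn`). From below, that increment exceeds exp(-2|b|₁) times the
-- variance of b'J for a step b (`exp_neg_mul_tiltedVariance_lt`), and on the cone the variance is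
-- at least a cone factor times |b_T|₁|b|_∞. Small λ then gives |Δ|₁ ≤ 1/2, so the exponential is at
-- least 1/e, and cancelling |Δ_T|₁ leaves the maximum-norm bound R (`norm_sub_le_of_isMinOn`).
-- Moments of order one and two close to their means keep the Monte Carlo cone factor above F(α-2)/α
-- (`factor_mul_le_tiltedVariance`). An error of at most δ < θ*_min/2 makes thresholding exact.
--
-- Probabilistic part. The data mean is handled by Hoeffding's inequality. The Monte Carlo moments
-- are ratios of chain averages; a ratio exceeds ν+τ exactly when the sum of w(G-ν-τ) is positive,
-- so a single additive tail bound suffices (`IsMarkovChain.ratio_tail`). That bound comes from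
-- Chernoff's method: the exponential moment is a product of operators, and reversibility with a
-- spectral gap controls each factor in weighted ℓ² (`sum_mul_exp_mul_sq_le`). A union bound over d̄
-- + d̄ + d̄² events costs at most 3ε.

namespace IsingLasso

/-! ### Spectral gap of a reversible finite chain. -/

section Spectral

variable {S : Type*} [Fintype S] [DecidableEq S]

theorem mem_spectrum_of_mulVec_eq_smul {P : Matrix S S ℝ} {ρ : ℝ} {g : S → ℝ} (hg : g ≠ 0)
    (h : P.mulVec g = ρ • g) : ρ ∈ spectrum ℝ P := by
  rw [spectrum.mem_iff, Matrix.isUnit_iff_isUnit_det, isUnit_iff_ne_zero, not_not,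
    ← Matrix.exists_mulVec_eq_zero_iff]
  refine ⟨g, hg, ?_⟩
  rw [Matrix.sub_mulVec, h, Algebra.algebraMap_eq_smul_one, Matrix.smul_mulVec, Matrix.one_mulVec,
    sub_self]

theorem exists_mulVec_eq_smul_of_mem_spectrum {P : Matrix S S ℝ} {ρ : ℝ}
    (h : ρ ∈ spectrum ℝ P) : ∃ g ≠ 0, P.mulVec g = ρ • g := by
  rw [spectrum.mem_iff, Matrix.isUnit_iff_isUnit_det, isUnit_iff_ne_zero, not_not,
    ← Matrix.exists_mulVec_eq_zero_iff] at h
  obtain ⟨g, hg, h⟩ := h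
  refine ⟨g, hg, ?_⟩
  rw [Matrix.sub_mulVec, Algebra.algebraMap_eq_smul_one, Matrix.smul_mulVec, Matrix.one_mulVec,
    sub_eq_zero] at h
  exact h.symm

theorem finite_abs_spectrum (P : Matrix S S ℝ) :
    {x : ℝ | ∃ ρ ∈ spectrum ℝ P \ {1}, x = |ρ|}.Finite := by
  refine (P.finite_spectrum.image fun ρ : ℝ => |ρ|).subset ?_
  rintro x ⟨ρ, hρ, rfl⟩
  exact ⟨ρ, hρ.1, rfl⟩

theorem kappa_nonneg (P : Matrix S S ℝ) : 0 ≤ kappa P := by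
  apply Real.sSup_nonneg
  rintro x ⟨ρ, -, rfl⟩
  exact abs_nonneg ρ

theorem abs_le_kappa {P : Matrix S S ℝ} {ρ : ℝ} (h : ρ ∈ spectrum ℝ P) (h1 : ρ ≠ 1) :
    |ρ| ≤ kappa P :=
  le_csSup (finite_abs_spectrum P).bddAbove ⟨ρ, ⟨h, h1⟩, rfl⟩

/-- A reversible chain whose only harmonic functions are constants contracts mean-zero functions
by the factor `kappa P` in the weighted `ℓ²` norm. -/
theorem sum_mul_mulVec_sq_le {P : Matrix S S ℝ} {h : S → ℝ} (hpos : ∀ y, 0 < h y)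
    (hrev : ∀ y y', h y * P y y' = h y' * P y' y)
    (hfix : ∀ g, P.mulVec g = g → ∀ y y', g y = g y')
    (r : S → ℝ) (hr : ∑ y, h y * r y = 0) :
    ∑ y, h y * P.mulVec r y ^ 2 ≤ kappa P ^ 2 * ∑ y, h y * r y ^ 2 := by
  have hs : ∀ y, 0 < √(h y) := fun y => Real.sqrt_pos.2 (hpos y)
  have hsq : ∀ y, √(h y) * √(h y) = h y := fun y => Real.mul_self_sqrt (hpos y).le
  -- Conjugating by the square root of the stationary density turns reversibility into symmetry, so
  -- an orthonormal eigenbasis is available.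
  set A : Matrix S S ℝ := Matrix.of fun y y' => √(h y) * P y y' / √(h y') with hAdef
  have hA : A.IsHermitian := by
    ext y y'
    simp only [Matrix.conjTranspose_apply, star_trivial, hAdef, Matrix.of_apply]
    rw [div_eq_div_iff (hs _).ne' (hs _).ne']
    have := hrev y y'
    rw [← hsq y, ← hsq y'] at this
    linarith
  have hconj : ∀ g : S → ℝ, A.mulVec (fun y => √(h y) * g y) = fun y => √(h y) * P.mulVec g y := by
    intro g
    ext y
    simp only [Matrix.mulVec, dotProduct, hAdef, Matrix.of_apply, Finset.mul_sum]
    refine Finset.sum_congr rfl fun y' _ => ?_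
    field_simp [(hs y').ne']
  set x : EuclideanSpace ℝ S := WithLp.toLp 2 fun y => √(h y) * r y with hx
  set w : EuclideanSpace ℝ S := WithLp.toLp 2 (A.mulVec x.ofLp) with hw
  set b := hA.eigenvectorBasis with hb
  have hxn : ∑ y, h y * r y ^ 2 = ‖x‖ ^ 2 := by
    rw [EuclideanSpace.norm_sq_eq]
    refine Finset.sum_congr rfl fun y _ => ?_
    rw [Real.norm_eq_abs, sq_abs, hx]
    simp only
    rw [mul_pow, sq (√(h y)), hsq]
  have hwn : ∑ y, h y * P.mulVec r y ^ 2 = ‖w‖ ^ 2 := by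
    rw [EuclideanSpace.norm_sq_eq]
    refine Finset.sum_congr rfl fun y _ => ?_
    rw [Real.norm_eq_abs, sq_abs, hw]
    simp only [hx, hconj]
    rw [mul_pow, sq (√(h y)), hsq]
  have hinner : ∀ i, inner ℝ (b i) w = hA.eigenvalues i * inner ℝ (b i) x := by
    intro i
    have h1 := hA.mulVec_eigenvectorBasis i
    simp only [EuclideanSpace.inner_eq_star_dotProduct, star_trivial, hw]
    rw [← Matrix.vecMul_transpose, ← Matrix.dotProduct_mulVec]
    have hT : A.transpose = A := by
      have := hA.eq
      rwa [Matrix.conjTranspose_eq_transpose_of_trivial] at this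
    rw [hT, h1, dotProduct_smul]
    simp [hb]
  rw [hxn, hwn, ← b.sum_sq_norm_inner_right, ← b.sum_sq_norm_inner_right, Finset.mul_sum]
  refine Finset.sum_le_sum fun i _ => ?_
  rw [hinner, norm_mul, mul_pow, Real.norm_eq_abs, Real.norm_eq_abs]
  -- the eigenvector of `P` that corresponds to the `i`-th eigenvector of `A`
  set g : S → ℝ := fun y => b i y / √(h y) with hg
  have hgb : (fun y => √(h y) * g y) = (b i).ofLp := by
    ext y
    simp only [hg]
    field_simp [(hs y).ne']
  have hPg : P.mulVec g = hA.eigenvalues i • g := by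
    have h1 := hA.mulVec_eigenvectorBasis i
    rw [← hb, ← hgb, hconj] at h1
    ext y
    have h2 := congrFun h1 y
    simp only [Pi.smul_apply, smul_eq_mul] at h2 ⊢
    exact mul_left_cancel₀ (hs y).ne' (by linarith)
  -- `kappa` discards the value 1 whatever its multiplicity. Components with eigenvalue 1 must
  -- therefore vanish: they correspond to constant functions, which are orthogonal to the mean-zero
  -- `r`.
  by_cases h1 : hA.eigenvalues i = 1
  · have hc := hfix g (by rw [hPg, h1, one_smul])
    have : inner ℝ (b i) x = 0 := by
      rw [EuclideanSpace.inner_eq_star_dotProduct, star_trivial, ← hgb]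
      simp only [hx, dotProduct]
      rcases isEmpty_or_nonempty S with hS | ⟨⟨y0⟩⟩
      · simp
      · calc ∑ y, √(h y) * r y * (√(h y) * g y) = ∑ y, g y0 * (h y * r y) :=
              Finset.sum_congr rfl fun y _ => by
                rw [hc y y0]; linear_combination (r y * g y0) * hsq y
          _ = 0 := by rw [← Finset.mul_sum, hr, mul_zero]
    simp [this]
  · have hg0 : g ≠ 0 := by
      intro h0
      have hbi : b i = 0 := by
        ext y
        rw [← hgb, h0]
        simp
      have := b.orthonormal.1 i
      rw [hbi, norm_zero] at this
      exact zero_ne_one this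
    gcongr
    exact abs_le_kappa (mem_spectrum_of_mulVec_eq_smul hg0 hPg) h1

/-- A stochastic matrix with positive diagonal has no real eigenvalue other than `1` outside
`(-1, 1)`. -/
theorem abs_lt_one_of_mem_spectrum {P : Matrix S S ℝ} (hnn : ∀ y y', 0 ≤ P y y')
    (hsum : ∀ y, ∑ y', P y y' = 1) (hdiag : ∀ y, 0 < P y y) {ρ : ℝ} (hρ : ρ ∈ spectrum ℝ P)
    (h1 : ρ ≠ 1) : |ρ| < 1 := by
  obtain ⟨g, hg, hPg⟩ := exists_mulVec_eq_smul_of_mem_spectrum hρ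
  obtain ⟨z, hz⟩ := Function.ne_iff.1 hg
  obtain ⟨y, -, hy⟩ := Finset.exists_max_image Finset.univ (fun y => |g y|) ⟨z, Finset.mem_univ z⟩
  have hgy : 0 < |g y| := (abs_pos.2 hz).trans_le (hy z (Finset.mem_univ z))
  have hval : ∑ y', P y y' * g y' = ρ * g y := congrFun hPg y
  -- compare the off-diagonal part with its bound
  have hoff : |(ρ - P y y) * g y| ≤ (1 - P y y) * |g y| := by
    have e1 : (ρ - P y y) * g y = ∑ y' ∈ Finset.univ.erase y, P y y' * g y' := by
      rw [sub_mul, ← hval, ← Finset.add_sum_erase _ _ (Finset.mem_univ y)]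
      ring
    have e2 : 1 - P y y = ∑ y' ∈ Finset.univ.erase y, P y y' := by
      rw [← hsum y, ← Finset.add_sum_erase _ _ (Finset.mem_univ y)]
      ring
    rw [e1, e2, Finset.sum_mul]
    refine (Finset.abs_sum_le_sum_abs _ _).trans (Finset.sum_le_sum fun y' _ => ?_)
    rw [abs_mul, abs_of_nonneg (hnn _ _)]
    exact mul_le_mul_of_nonneg_left (hy y' (Finset.mem_univ _)) (hnn _ _)
  rw [abs_mul] at hoff
  have h2 := le_of_mul_le_mul_right hoff hgy
  have h3 := hdiag y
  rw [abs_le] at h2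
  rw [abs_lt]
  exact ⟨by linarith, lt_of_le_of_ne (by linarith) h1⟩

theorem kappa_lt_one {P : Matrix S S ℝ} (hnn : ∀ y y', 0 ≤ P y y')
    (hsum : ∀ y, ∑ y', P y y' = 1) (hdiag : ∀ y, 0 < P y y) : kappa P < 1 := by
  rcases {x : ℝ | ∃ ρ ∈ spectrum ℝ P \ {1}, x = |ρ|}.eq_empty_or_nonempty with h | h
  · rw [kappa, h, Real.sSup_empty]
    exact zero_lt_one
  · obtain ⟨ρ, hρ, he⟩ := h.csSup_mem (finite_abs_spectrum P)
    rw [kappa, he]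
    exact abs_lt_one_of_mem_spectrum hnn hsum hdiag hρ.1 hρ.2

end Spectral

/-- Finite subadditivity over paths is all that the Chernoff bound needs, and it avoids
measurability of the path event. -/
theorem IsMarkovChain.measureReal_path_mem_le {S Ω : Type*} [MeasurableSpace Ω]
    [MeasurableSpace S] {μ : Measure Ω} [IsProbabilityMeasure μ]
    {q : S → ℝ} {P : Matrix S S ℝ} {N : ℕ} {Z : ℕ → Ω → S} (hZ : IsMarkovChain μ q P (N + 1) Z)
    (B : Finset (Fin (N + 1) → S)) :
    μ.real {ω | (fun k : Fin (N + 1) => Z k ω) ∈ B} ≤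
      ∑ z ∈ B, q (z 0) * ∏ k : Fin N, P (z k.castSucc) (z k.succ) := by
  have hsub : {ω | (fun k : Fin (N + 1) => Z k ω) ∈ B} ⊆
      ⋃ z ∈ B, {ω | (fun k : Fin (N + 1) => Z k ω) = z} := by
    intro ω hω
    simp only [Set.mem_iUnion]
    exact ⟨_, hω, rfl⟩
  refine (measureReal_mono hsub (measure_ne_top _ _)).trans ((measureReal_biUnion_finset_le _ _).trans ?_)
  refine Finset.sum_le_sum fun z _ => ?_
  -- `path_prob` takes an infinite sequence; the finite path is continued by its last state.
  have h1 := hZ.path_prob N (Nat.lt_succ_self N) fun k => z ⟨min k N, by omega⟩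
  have h2 : {ω | ∀ k ≤ N, Z k ω = z ⟨min k N, by omega⟩} =
      {ω | (fun k : Fin (N + 1) => Z k ω) = z} := by
    ext ω
    simp only [Set.mem_ofPred_eq, funext_iff]
    constructor
    · intro H k
      have := H k (by omega)
      rw [this]
      congr 1
      ext
      simp only
      omega
    · intro H k hk
      have := H ⟨k, by omega⟩
      simp only at this
      rw [this]
      congr 1
      ext
      simp only
      omega
  rw [h2, Finset.prod_range] at h1
  rw [h1]
  refine le_of_eq ?_
  congr 1
  refine Finset.prod_congr rfl fun k _ => ?_
  congr 2
  · ext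
    simp only [Fin.val_castSucc]
    omega
  · ext
    simp only [Fin.val_succ]
    omega

/-! ### Exponential inequalities for reversible Markov chains. -/

section ChainTail

variable {S : Type*} [Fintype S]

theorem sq_sum_mul_mul_le {h : S → ℝ} (hnn : ∀ y, 0 ≤ h y) (a b : S → ℝ) :
    (∑ y, h y * (a y * b y)) ^ 2 ≤ (∑ y, h y * a y ^ 2) * ∑ y, h y * b y ^ 2 := by
  refine Finset.sum_sq_le_sum_mul_sum_of_sq_le_mul _ (fun y _ => ?_) (fun y _ => ?_)
    fun y _ => le_of_eq ?_
  · exact mul_nonneg (hnn y) (sq_nonneg _)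
  · exact mul_nonneg (hnn y) (sq_nonneg _)
  · ring

/-- Exponential tilting of a function split into its mean `c` and a fluctuation `r` that has been
contracted by the factor `κ`. -/
theorem sum_mul_exp_mul_sq_le {h f r : S → ℝ} {κ x c N : ℝ} (hnn : ∀ y, 0 ≤ h y)
    (hsum : ∑ y, h y = 1) (hf0 : ∑ y, h y * f y = 0) (hf2 : ∑ y, h y * f y ^ 2 ≤ 1 / 4)
    (hf : ∀ y, |f y| ≤ 1) (hκ0 : 0 ≤ κ) (hκ1 : κ < 1) (hx0 : 0 ≤ x)
    (hx : x ≤ (1 - κ) / (1 + κ)) (hN : 0 ≤ N) (hr0 : ∑ y, h y * r y = 0)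
    (hr2 : ∑ y, h y * r y ^ 2 ≤ κ ^ 2 * N) :
    ∑ y, h y * (Real.exp (x * f y) * (c + r y) ^ 2) ≤
      Real.exp (x ^ 2 * ((1 + κ) / (2 * (1 - κ)))) * (c ^ 2 + N) := by
  have hxκ : x ≤ 1 - κ :=
    hx.trans (div_le_self (by linarith) (by linarith))
  have hxf : ∀ y, |x * f y| ≤ 1 := fun y => by
    rw [abs_mul, abs_of_nonneg hx0]
    exact mul_le_one₀ (by linarith) (abs_nonneg _) (hf y)
  have hA : ∑ y, h y * Real.exp (x * f y) ≤ 1 + x ^ 2 / 4 := by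
    calc ∑ y, h y * Real.exp (x * f y)
        ≤ ∑ y, (h y + x * (h y * f y) + x ^ 2 * (h y * f y ^ 2)) := by
          refine Finset.sum_le_sum fun y _ => ?_
          have h1 := (abs_le.1 (Real.abs_exp_sub_one_sub_id_le (hxf y))).2
          nlinarith [hnn y]
      _ ≤ 1 + x ^ 2 / 4 := by
          rw [Finset.sum_add_distrib, Finset.sum_add_distrib, ← Finset.mul_sum, ← Finset.mul_sum,
            hsum, hf0]
          nlinarith [sq_nonneg x]
  have hB0 : ∑ y, h y * (Real.exp (x * f y) - 1) ^ 2 ≤ x ^ 2 := by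
    calc ∑ y, h y * (Real.exp (x * f y) - 1) ^ 2
        ≤ ∑ y, (4 * x ^ 2) * (h y * f y ^ 2) := by
          refine Finset.sum_le_sum fun y _ => ?_
          have h1 := Real.abs_exp_sub_one_le (hxf y)
          have h2 : (Real.exp (x * f y) - 1) ^ 2 ≤ (2 * (x * f y)) ^ 2 := by
            rw [sq_le_sq, abs_mul 2, abs_of_pos (zero_lt_two' ℝ)]
            exact h1
          nlinarith [mul_le_mul_of_nonneg_left h2 (hnn y)]
      _ ≤ x ^ 2 := by
          rw [← Finset.mul_sum]
          nlinarith [sq_nonneg x]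
  set ν := √N with hν
  have hνN : ν ^ 2 = N := Real.sq_sqrt hN
  have hν0 : 0 ≤ ν := Real.sqrt_nonneg N
  have hB : |∑ y, h y * ((Real.exp (x * f y) - 1) * r y)| ≤ x * κ * ν := by
    apply abs_le_of_sq_le_sq _ (by positivity)
    calc _ ≤ _ := sq_sum_mul_mul_le hnn _ _
      _ ≤ x ^ 2 * (κ ^ 2 * N) :=
          mul_le_mul hB0 hr2 (Finset.sum_nonneg fun y _ => mul_nonneg (hnn y) (sq_nonneg _))
            (sq_nonneg x)
      _ = (x * κ * ν) ^ 2 := by rw [← hνN]; ring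
  have hC : ∑ y, h y * (Real.exp (x * f y) * r y ^ 2) ≤ κ * N := by
    calc ∑ y, h y * (Real.exp (x * f y) * r y ^ 2)
        ≤ ∑ y, Real.exp x * (h y * r y ^ 2) := by
          refine Finset.sum_le_sum fun y _ => ?_
          have h1 : Real.exp (x * f y) ≤ Real.exp x :=
            Real.exp_le_exp.2 (by nlinarith [(abs_le.1 (hf y)).2])
          nlinarith [mul_le_mul_of_nonneg_right h1 (mul_nonneg (hnn y) (sq_nonneg (r y)))]
      _ ≤ Real.exp x * (κ ^ 2 * N) := by
          rw [← Finset.mul_sum]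
          exact mul_le_mul_of_nonneg_left hr2 (Real.exp_pos x).le
      _ = (Real.exp x * κ) * (κ * N) := by ring
      _ ≤ 1 * (κ * N) := by
          refine mul_le_mul_of_nonneg_right ?_ (mul_nonneg hκ0 hN)
          -- The restriction on `x` enters here: κ ≤ 1 - x ≤ exp(-x), so one factor κ absorbs the
          -- growth of the tilt.
          have h1 : κ ≤ Real.exp (-x) := by linarith [Real.add_one_le_exp (-x)]
          calc Real.exp x * κ ≤ Real.exp x * Real.exp (-x) :=
                mul_le_mul_of_nonneg_left h1 (Real.exp_pos x).le
            _ = 1 := by rw [← Real.exp_add, add_neg_cancel, Real.exp_zero]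
      _ = κ * N := one_mul _
  -- In the cross term exp(xf) may be replaced by exp(xf) - 1 because `r` has mean zero; this makes
  -- that term of order `x`.
  have hsplit : ∑ y, h y * (Real.exp (x * f y) * (c + r y) ^ 2) =
      c ^ 2 * ∑ y, h y * Real.exp (x * f y) +
        2 * c * ∑ y, h y * ((Real.exp (x * f y) - 1) * r y) +
        ∑ y, h y * (Real.exp (x * f y) * r y ^ 2) := by
    have h0 : 2 * c * ∑ y, h y * ((Real.exp (x * f y) - 1) * r y) =
        2 * c * (∑ y, h y * ((Real.exp (x * f y) - 1) * r y) + ∑ y, h y * r y) := by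
      rw [hr0, add_zero]
    rw [h0, ← Finset.sum_add_distrib, Finset.mul_sum, Finset.mul_sum, ← Finset.sum_add_distrib,
      ← Finset.sum_add_distrib]
    exact Finset.sum_congr rfl fun y _ => by ring
  have hcB : 2 * c * ∑ y, h y * ((Real.exp (x * f y) - 1) * r y) ≤ 2 * |c| * (x * κ * ν) := by
    refine (le_abs_self _).trans ?_
    rw [abs_mul, abs_mul, abs_of_pos (zero_lt_two' ℝ)]
    exact mul_le_mul_of_nonneg_left hB (by positivity)
  set a := (1 + κ) / (2 * (1 - κ)) with ha
  have ha' : a * (1 - κ) = (1 + κ) / 2 := by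
    rw [ha]
    field_simp [(sub_pos.2 hκ1).ne']
  have ha0 : 0 ≤ a := div_nonneg (by linarith) (by linarith)
  -- The difference of the two sides of the final estimate is this quadratic form in x|c| and ν plus
  -- the nonnegative x²aN. Multiplied by 1 - κ, the form is a square plus a nonnegative multiple of
  -- (x|c|)².
  have hquad : 0 ≤ (a - 1 / 4) * (x * |c|) ^ 2 - 2 * κ * (x * |c|) * ν + (1 - κ) * ν ^ 2 := by
    have h1 : 0 ≤ (1 - κ) *
        ((a - 1 / 4) * (x * |c|) ^ 2 - 2 * κ * (x * |c|) * ν + (1 - κ) * ν ^ 2) := by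
      have : (1 - κ) * ((a - 1 / 4) * (x * |c|) ^ 2 - 2 * κ * (x * |c|) * ν + (1 - κ) * ν ^ 2) =
          (κ * (x * |c|) - (1 - κ) * ν) ^ 2 + (1 - κ) * (κ + 1 / 4) * (x * |c|) ^ 2 := by
        linear_combination (x * |c|) ^ 2 * ha'
      rw [this]
      have : 0 ≤ (1 - κ) * (κ + 1 / 4) := mul_nonneg (by linarith) (by linarith)
      positivity
    exact nonneg_of_mul_nonneg_right h1 (sub_pos.2 hκ1)
  have hexp : 1 + x ^ 2 * a ≤ Real.exp (x ^ 2 * a) := by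
    linarith [Real.add_one_le_exp (x ^ 2 * a)]
  have hc2 : |c| ^ 2 = c ^ 2 := sq_abs c
  calc ∑ y, h y * (Real.exp (x * f y) * (c + r y) ^ 2)
      ≤ c ^ 2 * (1 + x ^ 2 / 4) + 2 * |c| * (x * κ * ν) + κ * N := by
        rw [hsplit]
        have := mul_le_mul_of_nonneg_left hA (sq_nonneg c)
        linarith
    _ ≤ (1 + x ^ 2 * a) * (c ^ 2 + N) := by
        have h3 : 0 ≤ x ^ 2 * a * N := by positivity
        rw [mul_pow, hc2, hνN] at hquad
        nlinarith
    _ ≤ _ := mul_le_mul_of_nonneg_right hexp (by positivity)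

/-- The functions `D P D ⋯ P D` (with `N + 1` factors `D`). -/
def transfer (D : S → ℝ) (P : Matrix S S ℝ) : ℕ → S → ℝ
  | 0 => D
  | N + 1 => fun y => D y * P.mulVec (transfer D P N) y

/-- Induction on the length: once the first state `y` is fixed, the row `P y` acts as the initial
density of the remaining path. -/
theorem sum_path_eq_sum_transfer (D : S → ℝ) (P : Matrix S S ℝ) (N : ℕ) (q : S → ℝ) :
    ∑ z : Fin (N + 1) → S, q (z 0) * (∏ k : Fin N, P (z k.castSucc) (z k.succ)) * ∏ k, D (z k) =
      ∑ y, q y * transfer D P N y := by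
  induction N generalizing q with
  | zero =>
    rw [← (Equiv.funUnique (Fin 1) S).symm.sum_comp]
    simp [transfer]
  | succ N ih =>
    rw [← (Fin.consEquiv fun _ => S).sum_comp, Fintype.sum_prod_type]
    refine Finset.sum_congr rfl fun y _ => ?_
    have h1 := ih (P y)
    simp only [transfer, Matrix.mulVec, dotProduct]
    rw [← h1, Finset.mul_sum, Finset.mul_sum]
    refine Finset.sum_congr rfl fun z _ => ?_
    simp only [Fin.consEquiv_apply, Fin.cons_zero, Fin.prod_univ_succ (n := N),
      Fin.prod_univ_succ (n := N + 1), Fin.castSucc_zero, Fin.cons_succ, ← Fin.succ_castSucc]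
    ring

/-- Write the previous function as its mean `c` plus a fluctuation. `P` fixes the constant and
contracts the fluctuation, and c² plus the variance is again the second moment, so each transition
costs exactly one exponential factor. The exponent x/2 becomes x on squaring. -/
theorem sum_mul_transfer_sq_le {P : Matrix S S ℝ} {h f : S → ℝ} {κ x : ℝ} (hpos : ∀ y, 0 < h y)
    (hsum : ∑ y, h y = 1) (hrev : ∀ y y', h y * P y y' = h y' * P y' y)
    (hPsum : ∀ y, ∑ y', P y y' = 1)
    (hcontr : ∀ r : S → ℝ, ∑ y, h y * r y = 0 →
      ∑ y, h y * P.mulVec r y ^ 2 ≤ κ ^ 2 * ∑ y, h y * r y ^ 2)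
    (hf0 : ∑ y, h y * f y = 0) (hf2 : ∑ y, h y * f y ^ 2 ≤ 1 / 4)
    (hf : ∀ y, |f y| ≤ 1) (hκ0 : 0 ≤ κ) (hκ1 : κ < 1) (hx0 : 0 ≤ x)
    (hx : x ≤ (1 - κ) / (1 + κ)) (N : ℕ) :
    ∑ y, h y * transfer (fun y => Real.exp (x / 2 * f y)) P N y ^ 2 ≤
      Real.exp (x ^ 2 * ((1 + κ) / (2 * (1 - κ)))) ^ (N + 1) := by
  have hexp : ∀ y, Real.exp (x / 2 * f y) ^ 2 = Real.exp (x * f y) := fun y => by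
    rw [← Real.exp_nat_mul]
    congr 1
    push_cast
    ring
  induction N with
  | zero =>
    have := sum_mul_exp_mul_sq_le (r := 0) (c := 1) (N := 0) (fun y => (hpos y).le) hsum hf0 hf2 hf
      hκ0 hκ1 hx0 hx le_rfl (by simp) (by simp)
    simpa [transfer, hexp] using this
  | succ N ih =>
    set g := transfer (fun y => Real.exp (x / 2 * f y)) P N with hg
    set c := ∑ y, h y * g y with hc
    have hinv : ∀ u : S → ℝ, ∑ y, h y * P.mulVec u y = ∑ y, h y * u y := by
      intro u
      simp only [Matrix.mulVec, dotProduct, Finset.mul_sum]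
      rw [Finset.sum_comm]
      refine Finset.sum_congr rfl fun y' _ => ?_
      calc ∑ y, h y * (P y y' * u y') = ∑ y, (h y' * u y') * P y' y :=
            Finset.sum_congr rfl fun y _ => by rw [← mul_assoc, hrev]; ring
        _ = h y' * u y' := by rw [← Finset.mul_sum, hPsum, mul_one]
    have hPr : ∀ y, P.mulVec g y = c + P.mulVec (fun y => g y - c) y := by
      intro y
      simp only [Matrix.mulVec, dotProduct, mul_sub, Finset.sum_sub_distrib, ← Finset.sum_mul,
        hPsum]
      ring
    have hr0 : ∑ y, h y * (g y - c) = 0 := by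
      simp only [mul_sub, Finset.sum_sub_distrib, ← Finset.sum_mul, hsum, ← hc]
      ring
    have hvar : ∑ y, h y * (g y - c) ^ 2 = ∑ y, h y * g y ^ 2 - c ^ 2 := by
      have : ∀ y, h y * (g y - c) ^ 2 = h y * g y ^ 2 - 2 * c * (h y * g y) + c ^ 2 * h y :=
        fun y => by ring
      simp only [this, Finset.sum_add_distrib, Finset.sum_sub_distrib, ← Finset.mul_sum, hsum,
        ← hc]
      ring
    have hN : 0 ≤ ∑ y, h y * (g y - c) ^ 2 :=
      Finset.sum_nonneg fun y _ => mul_nonneg (hpos y).le (sq_nonneg _)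
    have key := sum_mul_exp_mul_sq_le (c := c) (fun y => (hpos y).le) hsum hf0 hf2 hf hκ0 hκ1 hx0
      hx hN ((hinv _).trans hr0) (hcontr _ hr0)
    rw [hvar, add_sub_cancel] at key
    simp only [transfer, ← hg, mul_pow, hexp, hPr]
    refine key.trans ?_
    rw [pow_succ' _ (N + 1)]
    exact mul_le_mul_of_nonneg_left ih (Real.exp_pos _).le

variable {Ω : Type*} [MeasurableSpace Ω] [MeasurableSpace S]

/-- On the event, the factor exp(s(∑ f - c)) is at least 1; inserting it and then summing over all
paths is the exponential Markov inequality. -/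
theorem IsMarkovChain.chernoff {μ : Measure Ω} [IsProbabilityMeasure μ] {q : S → ℝ}
    {P : Matrix S S ℝ} {N : ℕ} {Z : ℕ → Ω → S} (hZ : IsMarkovChain μ q P (N + 1) Z)
    (hq : ∀ y, 0 ≤ q y) (hP : ∀ y y', 0 ≤ P y y') (f : S → ℝ) {s : ℝ} (hs : 0 ≤ s) (c : ℝ) :
    μ.real {ω | c ≤ ∑ k ∈ Finset.range (N + 1), f (Z k ω)} ≤
      Real.exp (-(s * c)) * ∑ y, q y * transfer (fun y => Real.exp (s * f y)) P N y := by
  classical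
  have h1 := hZ.measureReal_path_mem_le (Finset.univ.filter fun z => c ≤ ∑ k, f (z k))
  have h2 : {ω | (fun k : Fin (N + 1) => Z k ω) ∈ Finset.univ.filter fun z => c ≤ ∑ k, f (z k)} =
      {ω | c ≤ ∑ k ∈ Finset.range (N + 1), f (Z k ω)} := by
    ext ω
    simp [Finset.sum_range]
  rw [h2] at h1
  refine h1.trans ?_
  rw [← sum_path_eq_sum_transfer, Finset.mul_sum]
  have hw : ∀ z : Fin (N + 1) → S, 0 ≤ q (z 0) * ∏ k : Fin N, P (z k.castSucc) (z k.succ) :=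
    fun z => mul_nonneg (hq _) (Finset.prod_nonneg fun k _ => hP _ _)
  calc _ ≤ ∑ z ∈ Finset.univ.filter fun z : Fin (N + 1) → S => c ≤ ∑ k, f (z k),
        Real.exp (-(s * c)) * (q (z 0) * (∏ k : Fin N, P (z k.castSucc) (z k.succ)) *
          ∏ k, Real.exp (s * f (z k))) := by
        refine Finset.sum_le_sum fun z hz => ?_
        have hz' : c ≤ ∑ k, f (z k) := (Finset.mem_filter.1 hz).2
        rw [← Real.exp_sum, ← Finset.mul_sum, mul_left_comm, ← Real.exp_add]
        refine le_mul_of_one_le_right (hw z) (Real.one_le_exp ?_)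
        nlinarith
    _ ≤ _ := by
        refine Finset.sum_le_sum_of_subset_of_nonneg (Finset.filter_subset _ _) fun z _ _ => ?_
        refine mul_nonneg (Real.exp_pos _).le (mul_nonneg (hw z) ?_)
        exact Finset.prod_nonneg fun k _ => (Real.exp_pos _).le

/-- Hoeffding's inequality for a reversible Markov chain with spectral gap `1 - κ`. -/
theorem IsMarkovChain.hoeffding {μ : Measure Ω} [IsProbabilityMeasure μ] {q : S → ℝ}
    {P : Matrix S S ℝ} {m : ℕ} {Z : ℕ → Ω → S} (hm : 0 < m) (hZ : IsMarkovChain μ q P m Z)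
    (hq : ∀ y, 0 ≤ q y) {h f : S → ℝ} {κ t : ℝ} (hpos : ∀ y, 0 < h y)
    (hsum : ∑ y, h y = 1) (hrev : ∀ y y', h y * P y y' = h y' * P y' y)
    (hP : ∀ y y', 0 ≤ P y y') (hPsum : ∀ y, ∑ y', P y y' = 1)
    (hcontr : ∀ r : S → ℝ, ∑ y, h y * r y = 0 →
      ∑ y, h y * P.mulVec r y ^ 2 ≤ κ ^ 2 * ∑ y, h y * r y ^ 2)
    (hf0 : ∑ y, h y * f y = 0) (hf2 : ∑ y, h y * f y ^ 2 ≤ 1 / 4)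
    (hf : ∀ y, |f y| ≤ 1) (hκ0 : 0 ≤ κ) (hκ1 : κ < 1) (ht0 : 0 ≤ t) (ht1 : t ≤ 1) :
    μ.real {ω | m * t ≤ ∑ k ∈ Finset.range m, f (Z k ω)} ≤
      √(∑ y, q y ^ 2 / h y) * Real.exp (-((1 - κ) / (1 + κ) * m * t ^ 2 / 4)) := by
  obtain ⟨N, rfl⟩ : ∃ N, m = N + 1 := ⟨m - 1, by omega⟩
  set β := (1 - κ) / (1 + κ) with hβ
  have hβ0 : 0 < β := div_pos (by linarith) (by linarith)
  have hx0 : 0 ≤ t * β := by positivity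
  have hx1 : t * β ≤ β := mul_le_of_le_one_left hβ0.le ht1
  -- The exponent per step is -xt/2 + x²/(4β), minimized at x = tβ with value -βt²/4. The condition
  -- x ≤ β is t ≤ 1.
  have h1 := hZ.chernoff hq hP f (by positivity :
    0 ≤ t * β / 2) ((N + 1 : ℕ) * t)
  have h2 := sum_mul_transfer_sq_le hpos hsum hrev hPsum hcontr hf0 hf2 hf hκ0 hκ1 hx0 hx1 N
  set g := transfer (fun y => Real.exp (t * β / 2 * f y)) P N with hg
  refine h1.trans ?_
  have h3 : ∑ y, q y * g y ≤ √(∑ y, q y ^ 2 / h y) *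
      Real.exp ((N + 1 : ℕ) * (t ^ 2 * β) / 4) := by
    -- Cauchy-Schwarz in the space weighted by `h`, with q/h against the transfer function, produces
    -- the factor β₁.
    have hc := sq_sum_mul_mul_le (fun y => (hpos y).le) (fun y => q y / h y) g
    have e1 : ∑ y, h y * (q y / h y * g y) = ∑ y, q y * g y :=
      Finset.sum_congr rfl fun y _ => by field_simp [(hpos y).ne']
    have e2 : ∑ y, h y * (q y / h y) ^ 2 = ∑ y, q y ^ 2 / h y :=
      Finset.sum_congr rfl fun y _ => by field_simp [(hpos y).ne']
    rw [e1, e2] at hc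
    have hq2 : 0 ≤ ∑ y, q y ^ 2 / h y :=
      Finset.sum_nonneg fun y _ => div_nonneg (sq_nonneg _) (hpos y).le
    refine le_of_abs_le (abs_le_of_sq_le_sq (hc.trans ?_) (by positivity))
    rw [mul_pow, Real.sq_sqrt hq2]
    refine mul_le_mul_of_nonneg_left (h2.trans (le_of_eq ?_)) hq2
    rw [← Real.exp_nat_mul, ← Real.exp_nat_mul]
    congr 1
    have : (1 + κ) / (2 * (1 - κ)) * β = 1 / 2 := by
      rw [hβ]
      field_simp [(sub_pos.2 hκ1).ne', (by linarith : 1 + κ ≠ 0)]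
    push_cast
    linear_combination ((N : ℝ) + 1) * t ^ 2 * β * this
  calc _ ≤ Real.exp (-(t * β / 2 * ((N + 1 : ℕ) * t))) * (√(∑ y, q y ^ 2 / h y) *
      Real.exp ((N + 1 : ℕ) * (t ^ 2 * β) / 4)) := mul_le_mul_of_nonneg_left h3 (Real.exp_pos _).le
    _ = _ := by
        rw [mul_left_comm, ← Real.exp_add]
        congr 2
        ring

/-- Tail bound for a self-normalized average along a reversible Markov chain. -/
theorem IsMarkovChain.ratio_tail {μ : Measure Ω} [IsProbabilityMeasure μ] {q : S → ℝ}
    {P : Matrix S S ℝ} {m : ℕ} {Z : ℕ → Ω → S} (hm : 0 < m) (hZ : IsMarkovChain μ q P m Z)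
    (hq : ∀ y, 0 ≤ q y) {h w G : S → ℝ} {κ τ ν M : ℝ} (hpos : ∀ y, 0 < h y)
    (hsum : ∑ y, h y = 1) (hrev : ∀ y y', h y * P y y' = h y' * P y' y)
    (hP : ∀ y y', 0 ≤ P y y') (hPsum : ∀ y, ∑ y', P y y' = 1)
    (hcontr : ∀ r : S → ℝ, ∑ y, h y * r y = 0 →
      ∑ y, h y * P.mulVec r y ^ 2 ≤ κ ^ 2 * ∑ y, h y * r y ^ 2)
    (hκ0 : 0 ≤ κ) (hκ1 : κ < 1) (hw0 : ∀ y, 0 ≤ w y) (hwM : ∀ y, w y ≤ M)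
    (hw1 : ∑ y, h y * w y = 1) (hG : ∀ y, |G y| ≤ 1) (hν : ∑ y, h y * (w y * G y) = ν)
    (hτ : 0 < τ) :
    μ.real {ω | 0 < ∑ k ∈ Finset.range m, w (Z k ω) * (G (Z k ω) - ν - τ)} ≤
      √(∑ y, q y ^ 2 / h y) * Real.exp (-((1 - κ) / (1 + κ) * m * τ ^ 2 / (16 * M ^ 2))) := by
  have hM1 : 1 ≤ M := by
    calc 1 = ∑ y, h y * w y := hw1.symm
      _ ≤ ∑ y, h y * M :=
          Finset.sum_le_sum fun y _ => mul_le_mul_of_nonneg_left (hwM y) (hpos y).le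
      _ = M := by rw [← Finset.sum_mul, hsum, one_mul]
  have hν1 : -1 ≤ ν := by
    have : ∑ y, h y * (w y * (G y + 1)) = ν + 1 := by
      simp only [mul_add, Finset.sum_add_distrib, hν, mul_one, hw1]
    have h2 : 0 ≤ ∑ y, h y * (w y * (G y + 1)) := Finset.sum_nonneg fun y _ =>
      mul_nonneg (hpos y).le (mul_nonneg (hw0 y) (by linarith [(abs_le.1 (hG y)).1]))
    linarith
  -- Here every summand is nonpositive, since G ≤ 1.
  by_cases hcase : 1 < ν + τ
  · have : {ω | 0 < ∑ k ∈ Finset.range m, w (Z k ω) * (G (Z k ω) - ν - τ)} = ∅ := by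
      rw [Set.eq_empty_iff_forall_notMem]
      intro ω hω
      rw [Set.mem_ofPred_eq] at hω
      refine (not_lt.2 ?_) hω
      refine Finset.sum_nonpos fun k _ => mul_nonpos_of_nonneg_of_nonpos (hw0 _) ?_
      linarith [(abs_le.1 (hG (Z k ω))).2]
    rw [this, measureReal_empty]
    positivity
  have hM0 : 0 < M := by linarith
  -- The shift by M(ν+τ) centres the range of w(G-ν-τ), an interval of length 2M. Subtracting the
  -- mean and dividing by 2M then gives |f| ≤ 1 and variance at most 1/4.
  have hu : ∀ y, |w y * (G y - ν - τ) + M * (ν + τ)| ≤ M := by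
    intro y
    obtain ⟨g1, g2⟩ := abs_le.1 (hG y)
    have h1 := hw0 y
    have h2 := hwM y
    push Not at hcase
    rw [abs_le]
    constructor <;> nlinarith
  have hEW : ∑ y, h y * (w y * (G y - ν - τ)) = -τ := by
    have : ∀ y, h y * (w y * (G y - ν - τ)) = h y * (w y * G y) - (ν + τ) * (h y * w y) :=
      fun y => by ring
    simp only [this, Finset.sum_sub_distrib, ← Finset.mul_sum, hν, hw1]
    ring
  set f : S → ℝ := fun y => (w y * (G y - ν - τ) + τ) / (2 * M) with hfdef
  have hf0 : ∑ y, h y * f y = 0 := by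
    have : ∀ y, h y * f y = (h y * (w y * (G y - ν - τ)) + τ * h y) / (2 * M) :=
      fun y => by simp only [hfdef]; ring
    simp only [this, ← Finset.sum_div, Finset.sum_add_distrib, ← Finset.mul_sum, hEW, hsum]
    simp
  set u : S → ℝ := fun y => w y * (G y - ν - τ) + M * (ν + τ) with hudef
  have hEu : ∑ y, h y * u y = M * (ν + τ) - τ := by
    simp only [hudef, mul_add, Finset.sum_add_distrib, hEW, ← Finset.sum_mul, hsum]
    ring
  have hfu : ∀ y, f y = (u y - (M * (ν + τ) - τ)) / (2 * M) := fun y => by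
    simp only [hfdef, hudef]
    ring
  have hubar : |M * (ν + τ) - τ| ≤ M := by
    rw [← hEu]
    calc |∑ y, h y * u y| ≤ ∑ y, h y * M := by
          refine (Finset.abs_sum_le_sum_abs _ _).trans (Finset.sum_le_sum fun y _ => ?_)
          rw [abs_mul, abs_of_pos (hpos y)]
          exact mul_le_mul_of_nonneg_left (hu y) (hpos y).le
      _ = M := by rw [← Finset.sum_mul, hsum, one_mul]
  have hf : ∀ y, |f y| ≤ 1 := by
    intro y
    rw [hfu, abs_div, abs_of_pos (by positivity : 0 < 2 * M), div_le_one (by positivity)]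
    have h1 := abs_sub (u y) (M * (ν + τ) - τ)
    have h2 := hu y
    simp only [hudef] at h1 ⊢
    linarith
  have hf2 : ∑ y, h y * f y ^ 2 ≤ 1 / 4 := by
    have e : ∀ y, h y * f y ^ 2 = (h y * u y ^ 2 - 2 * (M * (ν + τ) - τ) * (h y * u y) +
        (M * (ν + τ) - τ) ^ 2 * h y) / (4 * M ^ 2) := fun y => by
      rw [hfu]
      field_simp
      ring
    have h1 : ∑ y, h y * u y ^ 2 ≤ M ^ 2 := by
      calc ∑ y, h y * u y ^ 2 ≤ ∑ y, h y * M ^ 2 := by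
            refine Finset.sum_le_sum fun y _ => mul_le_mul_of_nonneg_left ?_ (hpos y).le
            exact sq_le_sq.2 ((hu y).trans (le_abs_self M))
        _ = M ^ 2 := by rw [← Finset.sum_mul, hsum, one_mul]
    simp only [e, ← Finset.sum_div, Finset.sum_add_distrib, Finset.sum_sub_distrib,
      ← Finset.mul_sum, hEu, hsum]
    rw [div_le_div_iff₀ (by positivity) (by norm_num)]
    nlinarith [sq_nonneg (M * (ν + τ) - τ)]
  have ht1 : τ / (2 * M) ≤ 1 := by
    rw [div_le_one (by positivity)]
    push Not at hcase
    linarith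
  refine (measureReal_mono ?_).trans ((hZ.hoeffding hm hq hpos hsum hrev hP hPsum hcontr hf0 hf2 hf
    hκ0 hκ1 (by positivity) ht1).trans (le_of_eq ?_))
  · intro ω hω
    simp only [Set.mem_ofPred_eq] at hω ⊢
    simp only [hfdef, ← Finset.sum_div, Finset.sum_add_distrib, Finset.sum_const,
      Finset.card_range, nsmul_eq_mul]
    rw [mul_div_assoc', div_le_div_iff_of_pos_right (by positivity)]
    linarith
  · congr 3
    field_simp
    ring

end ChainTail

/-! ### Finite exponential families: convexity and self-concordance. -/

section ExponentialFamily

variable {ι K : Type*} [Fintype ι] [Fintype K]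

/-- The log-partition function of the weighted exponential family with statistics `X`. -/
noncomputable def logPartition (v : K → ℝ) (X : K → ι → ℝ) (θ : ι → ℝ) : ℝ :=
  Real.log (∑ k, v k * Real.exp (θ ⬝ᵥ X k))

/-- The expectation of `g` under the exponential family with weights `v` and statistics `X`. -/
noncomputable def tiltedMean (v : K → ℝ) (X : K → ι → ℝ) (θ : ι → ℝ) (g : K → ℝ) : ℝ :=
  (∑ k, v k * Real.exp (θ ⬝ᵥ X k) * g k) / ∑ k, v k * Real.exp (θ ⬝ᵥ X k)

theorem abs_dotProduct_le {a b : ι → ℝ} (hb : ∀ i, |b i| ≤ 1) : |a ⬝ᵥ b| ≤ ∑ i, |a i| := by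
  refine (Finset.abs_sum_le_sum_abs _ _).trans (Finset.sum_le_sum fun i _ => ?_)
  rw [abs_mul]
  exact mul_le_of_le_one_right (abs_nonneg _) (hb i)

theorem tiltedMean_const_mul (v : K → ℝ) (X : K → ι → ℝ) (θ : ι → ℝ) (c : ℝ) (g : K → ℝ) :
    tiltedMean v X θ (fun k => c * g k) = c * tiltedMean v X θ g := by
  simp only [tiltedMean, mul_left_comm _ c, ← Finset.mul_sum, mul_div_assoc]

theorem tiltedMean_sum {α : Type*} (s : Finset α) (v : K → ℝ) (X : K → ι → ℝ) (θ : ι → ℝ)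
    (g : α → K → ℝ) :
    tiltedMean v X θ (fun k => ∑ a ∈ s, g a k) = ∑ a ∈ s, tiltedMean v X θ (g a) := by
  simp only [tiltedMean, Finset.mul_sum, ← Finset.sum_div]
  rw [Finset.sum_comm]

theorem tiltedMean_dotProduct (v : K → ℝ) (X : K → ι → ℝ) (θ b : ι → ℝ) :
    tiltedMean v X θ (fun k => b ⬝ᵥ X k) = ∑ i, b i * tiltedMean v X θ fun k => X k i := by
  simp only [dotProduct, ← tiltedMean_const_mul]
  exact tiltedMean_sum _ _ _ _ _

theorem tiltedMean_dotProduct_sq (v : K → ℝ) (X : K → ι → ℝ) (θ b : ι → ℝ) :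
    tiltedMean v X θ (fun k => (b ⬝ᵥ X k) ^ 2) =
      ∑ i, ∑ j, b i * b j * tiltedMean v X θ fun k => X k i * X k j := by
  have : ∀ k, (b ⬝ᵥ X k) ^ 2 = ∑ i, ∑ j, b i * b j * (X k i * X k j) := fun k => by
    rw [sq, dotProduct, Finset.sum_mul_sum]
    exact Finset.sum_congr rfl fun i _ => Finset.sum_congr rfl fun j _ => by ring
  simp only [this, tiltedMean_sum, tiltedMean_const_mul]

variable {v : K → ℝ} {X : K → ι → ℝ}

theorem partition_pos [Nonempty K] (hv : ∀ k, 0 < v k) (θ : ι → ℝ) :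
    0 < ∑ k, v k * Real.exp (θ ⬝ᵥ X k) :=
  Finset.sum_pos (fun k _ => mul_pos (hv k) (Real.exp_pos _)) Finset.univ_nonempty

theorem abs_tiltedMean_le [Nonempty K] (hv : ∀ k, 0 < v k) (θ : ι → ℝ) {g : K → ℝ} {B : ℝ}
    (hg : ∀ k, |g k| ≤ B) : |tiltedMean v X θ g| ≤ B := by
  rw [tiltedMean, abs_div, abs_of_pos (partition_pos hv θ), div_le_iff₀ (partition_pos hv θ),
    Finset.mul_sum]
  refine (Finset.abs_sum_le_sum_abs _ _).trans (Finset.sum_le_sum fun k _ => ?_)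
  have h := mul_pos (hv k) (Real.exp_pos (θ ⬝ᵥ X k))
  rw [abs_mul, abs_of_pos h, mul_comm]
  exact mul_le_mul_of_nonneg_right (hg k) h.le

/-- Convexity of the log-partition function. -/
theorem tiltedMean_le_logPartition_sub [Nonempty K] (hv : ∀ k, 0 < v k) (θ b : ι → ℝ) :
    tiltedMean v X θ (fun k => b ⬝ᵥ X k) ≤ logPartition v X (θ + b) - logPartition v X θ := by
  have h0 := partition_pos (X := X) hv θ
  have h1 := partition_pos (X := X) hv (θ + b)
  set m := tiltedMean v X θ (fun k => b ⬝ᵥ X k) with hm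
  rw [logPartition, logPartition, ← Real.log_div h1.ne' h0.ne', Real.le_log_iff_exp_le (by positivity),
    le_div_iff₀ h0]
  -- With `b ⬝ᵥ X k` centred at its mean, 1 + u ≤ exp u can be averaged and the linear term
  -- disappears.
  have hmean : ∑ k, v k * Real.exp (θ ⬝ᵥ X k) * (b ⬝ᵥ X k - m) = 0 := by
    simp only [mul_sub, Finset.sum_sub_distrib, ← Finset.sum_mul]
    rw [hm, tiltedMean, mul_div_cancel₀ _ h0.ne', sub_self]
  calc Real.exp m * ∑ k, v k * Real.exp (θ ⬝ᵥ X k)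
      = Real.exp m * ∑ k, v k * Real.exp (θ ⬝ᵥ X k) * (b ⬝ᵥ X k - m + 1) := by
        simp only [mul_add, Finset.sum_add_distrib, hmean, zero_add, mul_one]
    _ ≤ Real.exp m * ∑ k, v k * Real.exp (θ ⬝ᵥ X k) * Real.exp (b ⬝ᵥ X k - m) := by
        refine mul_le_mul_of_nonneg_left (Finset.sum_le_sum fun k _ => ?_) (Real.exp_pos _).le
        exact mul_le_mul_of_nonneg_left (Real.add_one_le_exp _)
          (mul_pos (hv k) (Real.exp_pos _)).le
    _ = ∑ k, v k * Real.exp ((θ + b) ⬝ᵥ X k) := by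
        rw [Finset.mul_sum]
        refine Finset.sum_congr rfl fun k _ => ?_
        rw [add_dotProduct, Real.exp_add, Real.exp_sub]
        field_simp

/-- Above -B the slopes of exp exceed exp(-B). Strictness is kept because it yields the
contradiction in `norm_sub_le_of_isMinOn`, whose condition on `lam` is not strict. -/
theorem exp_neg_mul_sq_lt {B x y : ℝ} (hx : -B ≤ x) (hy : -B ≤ y) (hxy : x ≠ y) :
    Real.exp (-B) * (x - y) ^ 2 < (x - y) * (Real.exp x - Real.exp y) := by
  wlog h : y < x generalizing x y
  · have := this hy hx hxy.symm (lt_of_le_of_ne (not_lt.1 h) hxy)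
    linarith
  have h1 : Real.exp (-B) ≤ Real.exp y := Real.exp_le_exp.2 hy
  have h2 : x - y + 1 < Real.exp (x - y) := Real.add_one_lt_exp (sub_pos.2 h).ne'
  have h3 : Real.exp x = Real.exp y * Real.exp (x - y) := by
    rw [← Real.exp_add]
    congr 1
    ring
  rw [h3]
  have h4 : Real.exp y * (x - y) < Real.exp y * (Real.exp (x - y) - 1) :=
    mul_lt_mul_of_pos_left (by linarith) (Real.exp_pos y)
  have h5 := mul_lt_mul_of_pos_left h4 (sub_pos.2 h)
  have h6 := mul_le_mul_of_nonneg_right h1 (sq_nonneg (x - y))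
  linarith

/-- Covariance through two independent copies, which allows pairwise comparison of increments. -/
theorem sum_sum_mul_sub_mul_sub {p : K → ℝ} (hp1 : ∑ k, p k = 1) (x u : K → ℝ) :
    ∑ k, ∑ l, p k * p l * ((x k - x l) * (u k - u l)) =
      2 * (∑ k, p k * (x k * u k) - (∑ k, p k * x k) * ∑ k, p k * u k) := by
  have : ∀ k l, p k * p l * ((x k - x l) * (u k - u l)) =
      (p k * (x k * u k)) * p l + p k * (p l * (x l * u l)) - (p k * x k) * (p l * u l) -
        (p k * u k) * (p l * x l) := fun k l => by ring
  simp only [this, Finset.sum_sub_distrib, Finset.sum_add_distrib, ← Finset.mul_sum,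
    ← Finset.sum_mul, hp1]
  ring

/-- A quantitative form of the monotonicity of the mean under exponential tilting. -/
theorem exp_neg_mul_variance_lt {p x : K → ℝ} {B : ℝ} (hp : ∀ k, 0 < p k) (hp1 : ∑ k, p k = 1)
    (hx : ∀ k, |x k| ≤ B) (hvar : 0 < ∑ k, p k * x k ^ 2 - (∑ k, p k * x k) ^ 2) :
    Real.exp (-(2 * B)) * (∑ k, p k * x k ^ 2 - (∑ k, p k * x k) ^ 2) <
      (∑ k, p k * Real.exp (x k) * x k) / (∑ k, p k * Real.exp (x k)) - ∑ k, p k * x k := by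
  have hK : Nonempty K := by
    by_contra h
    rw [not_nonempty_iff] at h
    simp at hp1
  have hE : 0 < ∑ k, p k * Real.exp (x k) :=
    Finset.sum_pos (fun k _ => mul_pos (hp k) (Real.exp_pos _)) Finset.univ_nonempty
  have hEB : ∑ k, p k * Real.exp (x k) ≤ Real.exp B := by
    calc ∑ k, p k * Real.exp (x k) ≤ ∑ k, p k * Real.exp B :=
          Finset.sum_le_sum fun k _ => mul_le_mul_of_nonneg_left
            (Real.exp_le_exp.2 (abs_le.1 (hx k)).2) (hp k).le
      _ = Real.exp B := by rw [← Finset.sum_mul, hp1, one_mul]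
  set V := ∑ k, p k * x k ^ 2 - (∑ k, p k * x k) ^ 2 with hV
  have hV2 : ∑ k, ∑ l, p k * p l * ((x k - x l) * (x k - x l)) = 2 * V := by
    rw [sum_sum_mul_sub_mul_sub hp1, hV]
    simp only [sq]
  have hC := sum_sum_mul_sub_mul_sub hp1 x fun k => Real.exp (x k)
  set C := ∑ k, p k * (x k * Real.exp (x k)) - (∑ k, p k * x k) * ∑ k, p k * Real.exp (x k)
    with hCdef
  have hpt : ∀ k l, Real.exp (-B) * (p k * p l * ((x k - x l) * (x k - x l))) ≤
      p k * p l * ((x k - x l) * (Real.exp (x k) - Real.exp (x l))) := fun k l => by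
    by_cases h : x k = x l
    · simp [h]
    · have h1 := exp_neg_mul_sq_lt (abs_le.1 (hx k)).1 (abs_le.1 (hx l)).1 h
      have h2 := mul_lt_mul_of_pos_left h1 (mul_pos (hp k) (hp l))
      linarith
  have hlt : Real.exp (-B) * V < C := by
    have hne : ∃ k l, x k ≠ x l := by
      by_contra h
      push Not at h
      have : ∑ k, ∑ l, p k * p l * ((x k - x l) * (x k - x l)) = 0 :=
        Finset.sum_eq_zero fun k _ => Finset.sum_eq_zero fun l _ => by rw [h k l]; ring
      linarith
    obtain ⟨k, l, hkl⟩ := hne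
    have h1 : ∑ k, ∑ l, Real.exp (-B) * (p k * p l * ((x k - x l) * (x k - x l))) <
        ∑ k, ∑ l, p k * p l * ((x k - x l) * (Real.exp (x k) - Real.exp (x l))) := by
      refine Finset.sum_lt_sum (fun k _ => Finset.sum_le_sum fun l _ => hpt k l)
        ⟨k, Finset.mem_univ k, Finset.sum_lt_sum (fun l _ => hpt k l) ⟨l, Finset.mem_univ l, ?_⟩⟩
      have h1 := exp_neg_mul_sq_lt (abs_le.1 (hx k)).1 (abs_le.1 (hx l)).1 hkl
      have h2 := mul_lt_mul_of_pos_left h1 (mul_pos (hp k) (hp l))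
      linarith
    simp only [← Finset.mul_sum] at h1
    rw [hV2] at h1
    linarith
  -- The shift of the mean under tilting is the covariance of x and exp x divided by the mean of exp
  -- x. The covariance contributes exp(-B) and the denominator, at most exp B, another exp(-B).
  have hCE : (∑ k, p k * Real.exp (x k) * x k) / (∑ k, p k * Real.exp (x k)) - ∑ k, p k * x k =
      C / ∑ k, p k * Real.exp (x k) := by
    rw [hCdef, sub_div, mul_div_cancel_right₀ _ hE.ne']
    congr 2
    exact Finset.sum_congr rfl fun k _ => by ring
  rw [hCE, lt_div_iff₀ hE]
  calc Real.exp (-(2 * B)) * V * ∑ k, p k * Real.exp (x k)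
      ≤ Real.exp (-(2 * B)) * V * Real.exp B :=
        mul_le_mul_of_nonneg_left hEB (mul_nonneg (Real.exp_pos _).le hvar.le)
    _ = Real.exp (-B) * V := by
        rw [mul_right_comm, ← Real.exp_add]
        congr 2
        ring
    _ < C := hlt

/-- The variance of the linear statistic with coefficients `b` under the exponential family at `θ`. -/
noncomputable def tiltedVariance (v : K → ℝ) (X : K → ι → ℝ) (θ b : ι → ℝ) : ℝ :=
  tiltedMean v X θ (fun k => (b ⬝ᵥ X k) ^ 2) - tiltedMean v X θ (fun k => b ⬝ᵥ X k) ^ 2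

theorem tiltedVariance_smul (v : K → ℝ) (X : K → ι → ℝ) (θ b : ι → ℝ) (c : ℝ) :
    tiltedVariance v X θ (c • b) = c ^ 2 * tiltedVariance v X θ b := by
  simp only [tiltedVariance, smul_dotProduct, smul_eq_mul, mul_pow, tiltedMean_const_mul]
  ring

theorem tiltedVariance_eq_sum (v : K → ℝ) (X : K → ι → ℝ) (θ b : ι → ℝ) :
    tiltedVariance v X θ b = ∑ i, ∑ j, b i * b j * (tiltedMean v X θ (fun k => X k i * X k j) -
      tiltedMean v X θ (fun k => X k i) * tiltedMean v X θ fun k => X k j) := by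
  rw [tiltedVariance, tiltedMean_dotProduct_sq, tiltedMean_dotProduct, sq, Finset.sum_mul_sum,
    ← Finset.sum_sub_distrib]
  refine Finset.sum_congr rfl fun i _ => ?_
  rw [← Finset.sum_sub_distrib]
  exact Finset.sum_congr rfl fun j _ => by ring

/-- The law at θ + b is the law at θ tilted by exp(b'X), and |b'X| ≤ |b|₁. -/
theorem exp_neg_mul_tiltedVariance_lt [Nonempty K] (hv : ∀ k, 0 < v k) (hX : ∀ k i, |X k i| ≤ 1)
    (θ b : ι → ℝ) (hvar : 0 < tiltedVariance v X θ b) :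
    Real.exp (-(2 * ∑ i, |b i|)) * tiltedVariance v X θ b <
      tiltedMean v X (θ + b) (fun k => b ⬝ᵥ X k) - tiltedMean v X θ fun k => b ⬝ᵥ X k := by
  have h0 := partition_pos (X := X) hv θ
  set Z := ∑ k, v k * Real.exp (θ ⬝ᵥ X k) with hZ
  set p : K → ℝ := fun k => v k * Real.exp (θ ⬝ᵥ X k) / Z with hp
  have hmean : ∀ g : K → ℝ, tiltedMean v X θ g = ∑ k, p k * g k := fun g => by
    rw [tiltedMean, Finset.sum_div]
    exact Finset.sum_congr rfl fun k _ => by rw [hp]; ring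
  have hmean' : tiltedMean v X (θ + b) (fun k => b ⬝ᵥ X k) =
      (∑ k, p k * Real.exp (b ⬝ᵥ X k) * (b ⬝ᵥ X k)) / ∑ k, p k * Real.exp (b ⬝ᵥ X k) := by
    have e1 : ∑ k, p k * Real.exp (b ⬝ᵥ X k) * (b ⬝ᵥ X k) =
        (∑ k, v k * Real.exp ((θ + b) ⬝ᵥ X k) * (b ⬝ᵥ X k)) / Z := by
      rw [Finset.sum_div]
      refine Finset.sum_congr rfl fun k _ => ?_
      rw [hp, add_dotProduct, Real.exp_add]
      ring
    have e2 : ∑ k, p k * Real.exp (b ⬝ᵥ X k) = (∑ k, v k * Real.exp ((θ + b) ⬝ᵥ X k)) / Z := by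
      rw [Finset.sum_div]
      refine Finset.sum_congr rfl fun k _ => ?_
      rw [hp, add_dotProduct, Real.exp_add]
      ring
    rw [e1, e2, div_div_div_cancel_right₀ h0.ne', tiltedMean]
  rw [hmean', hmean]
  rw [tiltedVariance, hmean, hmean] at hvar ⊢
  refine exp_neg_mul_variance_lt (fun k => div_pos (mul_pos (hv k) (Real.exp_pos _)) h0) ?_
    (fun k => abs_dotProduct_le (hX k)) hvar
  rw [hp, ← Finset.sum_div, ← hZ, div_self h0.ne']

end ExponentialFamily

/-! ### Deterministic analysis of the Lasso. -/

section Lasso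

variable {ι K : Type*} [Fintype ι] [Fintype K]

/-- The penalized negative log-likelihood with empirical mean `a` of the statistics. -/
noncomputable def penalizedLoss (v : K → ℝ) (X : K → ι → ℝ) (a : ι → ℝ) (lam : ℝ) (θ : ι → ℝ) : ℝ :=
  -(θ ⬝ᵥ a) + logPartition v X θ + lam * ∑ i, |θ i|

variable {v : K → ℝ} {X : K → ι → ℝ} {a θs θhat : ι → ℝ} {lam z ξ : ℝ}

theorem neg_mul_le_of_grad_le (hgrad : ∀ i, |tiltedMean v X θs (fun k => X k i) - a i| ≤ z)
    (b : ι → ℝ) :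
    -(z * ∑ i, |b i|) ≤ tiltedMean v X θs (fun k => b ⬝ᵥ X k) - b ⬝ᵥ a := by
  rw [tiltedMean_dotProduct, dotProduct, ← Finset.sum_sub_distrib, Finset.mul_sum,
    ← Finset.sum_neg_distrib]
  refine Finset.sum_le_sum fun i _ => ?_
  rw [← mul_sub]
  have h1 : |b i * (tiltedMean v X θs (fun k => X k i) - a i)| ≤ z * |b i| := by
    rw [abs_mul, mul_comm]
    exact mul_le_mul_of_nonneg_right (hgrad i) (abs_nonneg _)
  linarith [(abs_le.1 h1).1]

/-- The estimator is constrained only where a minimizer exists. By convexity the unpenalized loss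
lies above its tangent at `θs`, which falls at rate at most `z` in ℓ₁ norm; the penalty grows at the
larger rate `lam`, so the objective is coercive. -/
theorem exists_isMinOn_penalizedLoss [Nonempty K] (hv : ∀ k, 0 < v k)
    (hgrad : ∀ i, |tiltedMean v X θs (fun k => X k i) - a i| ≤ z) (hz : 0 ≤ z) (hlam : z < lam) :
    ∃ θ, IsMinOn (penalizedLoss v X a lam) Set.univ θ := by
  have hcont : Continuous (penalizedLoss v X a lam) := by
    have h1 : Continuous fun θ : ι → ℝ => logPartition v X θ := by
      unfold logPartition
      refine Continuous.log ?_ fun θ => (partition_pos hv θ).ne'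
      simp only [dotProduct]
      fun_prop
    unfold penalizedLoss
    simp only [dotProduct]
    fun_prop
  have hlow : ∀ θ : ι → ℝ, (lam - z) * ‖θ‖ +
      (logPartition v X θs - θs ⬝ᵥ a - z * ∑ i, |θs i|) ≤ penalizedLoss v X a lam θ := by
    intro θ
    have h1 := tiltedMean_le_logPartition_sub (X := X) hv θs (θ - θs)
    have h2 := neg_mul_le_of_grad_le hgrad (θ - θs)
    rw [add_sub_cancel] at h1
    have h3 : ∑ i, |(θ - θs) i| ≤ ∑ i, |θ i| + ∑ i, |θs i| := by
      rw [← Finset.sum_add_distrib]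
      exact Finset.sum_le_sum fun i _ => abs_sub _ _
    have h4 : ‖θ‖ ≤ ∑ i, |θ i| := by
      refine (pi_norm_le_iff_of_nonneg (Finset.sum_nonneg fun i _ => abs_nonneg _)).2 fun i => ?_
      exact Finset.single_le_sum (f := fun i => |θ i|) (fun i _ => abs_nonneg _)
        (Finset.mem_univ i)
    rw [sub_dotProduct] at h2
    have h5 := mul_le_mul_of_nonneg_left h3 hz
    have h6 := mul_le_mul_of_nonneg_left h4 (sub_pos.2 hlam).le
    unfold penalizedLoss
    linarith
  have htend : Filter.Tendsto (penalizedLoss v X a lam) (Filter.cocompact _) Filter.atTop := by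
    refine Filter.tendsto_atTop_mono hlow ?_
    refine Filter.tendsto_atTop_add_const_right _ _ ?_
    exact (tendsto_norm_cocompact_atTop).const_mul_atTop (sub_pos.2 hlam)
  obtain ⟨θ, hθ⟩ := hcont.exists_forall_le htend
  exact ⟨θ, fun y _ => hθ y⟩

variable [DecidableEq ι] {T : Finset ι}

/-- The minimizer is compared with an intermediate point of the segment from `θs`. Convexity bounds
the directional derivative there by the decrease of the penalty, without subgradient conditions; the
division by 1 - s requires s < 1. -/
theorem tiltedMean_sub_le_of_isMinOn [Nonempty K] (hv : ∀ k, 0 < v k)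
    (hgrad : ∀ i, |tiltedMean v X θs (fun k => X k i) - a i| ≤ z) (hlam : 0 ≤ lam)
    (hmin : IsMinOn (penalizedLoss v X a lam) Set.univ θhat) (hT : ∀ i ∉ T, θs i = 0)
    {s : ℝ} (hs0 : 0 ≤ s) (hs1 : s < 1) :
    tiltedMean v X (θs + s • (θhat - θs)) (fun k => (θhat - θs) ⬝ᵥ X k) -
        tiltedMean v X θs (fun k => (θhat - θs) ⬝ᵥ X k) ≤
      (lam + z) * ∑ i ∈ T, |(θhat - θs) i| - (lam - z) * ∑ i ∈ Tᶜ, |(θhat - θs) i| := by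
  set Δ := θhat - θs with hΔ
  set y := θs + s • Δ with hy
  have hyΔ : y + (1 - s) • Δ = θhat := by
    rw [hy, hΔ]
    module
  have h1 := tiltedMean_le_logPartition_sub (X := X) hv y ((1 - s) • Δ)
  rw [hyΔ] at h1
  simp only [smul_dotProduct, smul_eq_mul, tiltedMean_const_mul] at h1
  have h2 : penalizedLoss v X a lam θhat ≤ penalizedLoss v X a lam y := hmin (Set.mem_univ y)
  have h3 : ∑ i, |y i| ≤ (1 - s) * ∑ i, |θs i| + s * ∑ i, |θhat i| := by
    rw [Finset.mul_sum, Finset.mul_sum, ← Finset.sum_add_distrib]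
    refine Finset.sum_le_sum fun i _ => ?_
    have : y i = (1 - s) * θs i + s * θhat i := by
      simp only [hy, hΔ, Pi.add_apply, Pi.smul_apply, Pi.sub_apply, smul_eq_mul]
      ring
    rw [this]
    refine (abs_add_le _ _).trans (le_of_eq ?_)
    rw [abs_mul, abs_mul, abs_of_nonneg hs0, abs_of_pos (sub_pos.2 hs1)]
  have h4 : θhat ⬝ᵥ a - y ⬝ᵥ a = (1 - s) * (Δ ⬝ᵥ a) := by
    rw [← hyΔ, add_dotProduct, smul_dotProduct, smul_eq_mul]
    ring
  have h5 : tiltedMean v X y (fun k => Δ ⬝ᵥ X k) - Δ ⬝ᵥ a ≤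
      lam * (∑ i, |θs i| - ∑ i, |θhat i|) := by
    have h6 := mul_le_mul_of_nonneg_left h3 hlam
    unfold penalizedLoss at h2
    refine le_of_mul_le_mul_left ?_ (sub_pos.2 hs1)
    linarith
  have h7 := neg_mul_le_of_grad_le hgrad Δ
  have h8 : ∑ i, |θs i| - ∑ i, |θhat i| ≤ ∑ i ∈ T, |Δ i| - ∑ i ∈ Tᶜ, |Δ i| := by
    rw [← Finset.sum_add_sum_compl T fun i => |θs i|,
      ← Finset.sum_add_sum_compl T fun i => |θhat i|]
    have e1 : ∑ i ∈ Tᶜ, |θs i| = 0 :=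
      Finset.sum_eq_zero fun i hi => by rw [hT i (Finset.mem_compl.1 hi), abs_zero]
    have e2 : ∑ i ∈ Tᶜ, |Δ i| = ∑ i ∈ Tᶜ, |θhat i| :=
      Finset.sum_congr rfl fun i hi => by
        rw [hΔ, Pi.sub_apply, hT i (Finset.mem_compl.1 hi), sub_zero]
    have e3 : ∑ i ∈ T, |θs i| ≤ ∑ i ∈ T, |Δ i| + ∑ i ∈ T, |θhat i| := by
      rw [← Finset.sum_add_distrib]
      refine Finset.sum_le_sum fun i _ => ?_
      rw [hΔ, Pi.sub_apply, abs_sub_comm]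
      linarith [abs_sub_abs_le_abs_sub (θs i) (θhat i)]
    linarith
  have h9 := mul_le_mul_of_nonneg_left h8 hlam
  rw [← Finset.sum_add_sum_compl T fun i => |Δ i|] at h7
  linarith

/-- The Lasso error bound in maximum norm, in terms of a cone invertibility factor `Φ`. -/
theorem norm_sub_le_of_isMinOn [Nonempty K] (hv : ∀ k, 0 < v k) (hX : ∀ k i, |X k i| ≤ 1)
    (hξ : 1 < ξ)
    (hgrad : ∀ i, |tiltedMean v X θs (fun k => X k i) - a i| ≤ (ξ - 1) / (ξ + 1) * lam)
    (hlam : 0 < lam) (hmin : IsMinOn (penalizedLoss v X a lam) Set.univ θhat)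
    (hT : ∀ i ∉ T, θs i = 0) {Φ : ℝ} (hΦ : 0 < Φ)
    (hcone : ∀ b : ι → ℝ, b ≠ 0 → ∑ i ∈ Tᶜ, |b i| ≤ ξ * ∑ i ∈ T, |b i| →
      Φ * ((∑ i ∈ T, |b i|) * ‖b‖) ≤ tiltedVariance v X θs b)
    (hsmall : lam * (ξ + 1) * T.card ≤ Real.exp (-1) * Φ) :
    ‖θhat - θs‖ ≤ 2 * Real.exp 1 * ξ * lam / ((ξ + 1) * Φ) := by
  have hbase : ∀ s : ℝ, 0 ≤ s → s < 1 →
      tiltedMean v X (θs + s • (θhat - θs)) (fun k => (θhat - θs) ⬝ᵥ X k) -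
        tiltedMean v X θs (fun k => (θhat - θs) ⬝ᵥ X k) ≤
      2 * lam / (ξ + 1) * (ξ * ∑ i ∈ T, |(θhat - θs) i| - ∑ i ∈ Tᶜ, |(θhat - θs) i|) := by
    intro s hs0 hs1
    -- For z = (ξ-1)/(ξ+1)·λ one has λ + z = 2ξλ/(ξ+1) and λ - z = 2λ/(ξ+1).
    refine (tiltedMean_sub_le_of_isMinOn hv hgrad hlam.le hmin hT hs0 hs1).trans (le_of_eq ?_)
    field_simp [(by linarith : ξ + 1 ≠ 0)]
    ring
  set Δ := θhat - θs with hΔ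
  set tT := ∑ i ∈ T, |Δ i| with htT
  set tC := ∑ i ∈ Tᶜ, |Δ i| with htC
  have htsum : ∑ i, |Δ i| = tT + tC := (Finset.sum_add_sum_compl T _).symm
  have hξ1 : 0 < ξ + 1 := by linarith
  have hc0 : 0 < 2 * lam / (ξ + 1) := by positivity
  by_cases hΔ0 : Δ = 0
  · rw [hΔ0, norm_zero]
    positivity
  -- At s = 0 the left side vanishes, which is the cone condition.
  have hin : tC ≤ ξ * tT := by
    have := hbase 0 le_rfl one_pos
    rw [zero_smul, add_zero, sub_self] at this
    have := nonneg_of_mul_nonneg_right this hc0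
    linarith
  have hnorm : 0 < ‖Δ‖ := norm_pos_iff.2 hΔ0
  have htC0 : 0 ≤ tC := Finset.sum_nonneg fun i _ => abs_nonneg _
  have htT0 : 0 < tT := by
    refine lt_of_le_of_ne (Finset.sum_nonneg fun i _ => abs_nonneg _) fun h => hΔ0 ?_
    rw [← h, mul_zero] at hin
    have hs : ∑ i, |Δ i| = 0 := by linarith
    ext i
    exact abs_eq_zero.1 ((Finset.sum_eq_zero_iff_of_nonneg fun i _ => abs_nonneg _).1 hs i
      (Finset.mem_univ i))
  have hV := hcone Δ hΔ0 hin
  set V := tiltedVariance v X θs Δ with hVdef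
  have hV0 : 0 < V := lt_of_lt_of_le (by positivity) hV
  have htcard : tT ≤ T.card * ‖Δ‖ := by
    rw [htT, ← nsmul_eq_mul]
    exact Finset.sum_le_card_nsmul _ _ _ fun i _ => norm_le_pi_norm Δ i
  -- the self-concordance bound along the segment
  have hstep : ∀ s : ℝ, 0 < s → s < 1 → Real.exp (-(2 * (s * (tT + tC)))) * (s * V) <
      2 * lam / (ξ + 1) * (ξ * tT - tC) := by
    intro s hs0 hs1
    refine lt_of_lt_of_le ?_ (hbase s hs0.le hs1)
    have h1 := exp_neg_mul_tiltedVariance_lt hv hX θs (s • Δ) (by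
      rw [tiltedVariance_smul]
      positivity)
    have h2 : ∑ i, |(s • Δ) i| = s * (tT + tC) := by
      simp only [Pi.smul_apply, smul_eq_mul, abs_mul, abs_of_pos hs0, ← Finset.mul_sum, htsum]
    rw [h2, tiltedVariance_smul] at h1
    simp only [smul_dotProduct, smul_eq_mul, tiltedMean_const_mul] at h1
    refine lt_of_mul_lt_mul_left ?_ hs0.le
    linarith
  -- Otherwise shrink Δ to ℓ₁ norm 1/2, where the exponential factor is 1/e. Then u - 1/2 ≤ u²/2
  -- with u = (ξ+1)s·tT makes the upper bound quadratic in tT, and `hsmall` with the cone bound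
  -- contradicts the strict inequality.
  have hhalf : tT + tC ≤ 1 / 2 := by
    by_contra hlt
    push Not at hlt
    have ht0 : 0 < tT + tC := by linarith
    set s := 1 / (2 * (tT + tC)) with hs
    have hst : s * (tT + tC) = 1 / 2 := by
      rw [hs]
      field_simp
    have hs0 : 0 < s := by positivity
    have hs1 : s < 1 := by
      rw [hs, div_lt_one (by positivity)]
      linarith
    have h1 := hstep s hs0 hs1
    rw [hst] at h1
    norm_num at h1
    have hsC : s * tC = 1 / 2 - s * tT := by linarith
    have h2 : s * (2 * lam / (ξ + 1) * (ξ * tT - tC)) ≤ lam * (ξ + 1) * (s * tT) ^ 2 := by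
      have : s * (2 * lam / (ξ + 1) * (ξ * tT - tC)) =
          2 * lam / (ξ + 1) * ((ξ + 1) * (s * tT) - 1 / 2) := by
        linear_combination -(2 * lam / (ξ + 1)) * hsC
      rw [this]
      have h3 : (ξ + 1) * (s * tT) - 1 / 2 ≤ ((ξ + 1) * (s * tT)) ^ 2 / 2 := by
        nlinarith [sq_nonneg ((ξ + 1) * (s * tT) - 1)]
      refine (mul_le_mul_of_nonneg_left h3 hc0.le).trans (le_of_eq ?_)
      field_simp
    have h4 := mul_lt_mul_of_pos_left h1 hs0
    have h5 : Real.exp (-1) * (Φ * (tT * ‖Δ‖)) ≤ Real.exp (-1) * V :=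
      mul_le_mul_of_nonneg_left hV (Real.exp_pos _).le
    have h6 : lam * (ξ + 1) * tT ≤ Real.exp (-1) * Φ * ‖Δ‖ := by
      calc lam * (ξ + 1) * tT ≤ lam * (ξ + 1) * (T.card * ‖Δ‖) :=
            mul_le_mul_of_nonneg_left htcard (by positivity)
        _ = lam * (ξ + 1) * T.card * ‖Δ‖ := by ring
        _ ≤ Real.exp (-1) * Φ * ‖Δ‖ := mul_le_mul_of_nonneg_right hsmall hnorm.le
    have h7 : lam * (ξ + 1) * (s * tT) ^ 2 ≤ s ^ 2 * (Real.exp (-1) * V) := by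
      calc lam * (ξ + 1) * (s * tT) ^ 2 = s ^ 2 * tT * (lam * (ξ + 1) * tT) := by ring
        _ ≤ s ^ 2 * tT * (Real.exp (-1) * Φ * ‖Δ‖) :=
            mul_le_mul_of_nonneg_left h6 (by positivity)
        _ = s ^ 2 * (Real.exp (-1) * (Φ * (tT * ‖Δ‖))) := by ring
        _ ≤ _ := mul_le_mul_of_nonneg_left h5 (by positivity)
    linarith
  -- Limit s → 1, needed because the upper bound is available only for s < 1.
  have hfin : Real.exp (-1) * V ≤ 2 * lam / (ξ + 1) * (ξ * tT) := by
    have hall : ∀ s : ℝ, 0 < s → s < 1 → s * (Real.exp (-1) * V) ≤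
        2 * lam / (ξ + 1) * (ξ * tT) := by
      intro s hs0 hs1
      have h1 := hstep s hs0 hs1
      have h2 : Real.exp (-1) ≤ Real.exp (-(2 * (s * (tT + tC)))) := by
        refine Real.exp_le_exp.2 ?_
        nlinarith
      have h3 := mul_le_mul_of_nonneg_right h2 (mul_pos hs0 hV0).le
      have h4 := mul_nonneg hc0.le htC0
      linarith
    by_contra hlt
    push Not at hlt
    set A := Real.exp (-1) * V with hA
    have hA0 : 0 < A := by positivity
    set C := 2 * lam / (ξ + 1) * (ξ * tT) with hC
    have hC0 : 0 < C := by positivity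
    obtain ⟨s, hs1, hs2⟩ := exists_between ((div_lt_one hA0).2 hlt)
    have h1 := hall s ((div_pos hC0 hA0).trans hs1) hs2
    rw [div_lt_iff₀ hA0] at hs1
    linarith
  have h1 : Real.exp (-1) * (Φ * (tT * ‖Δ‖)) ≤ 2 * lam / (ξ + 1) * (ξ * tT) :=
    (mul_le_mul_of_nonneg_left hV (Real.exp_pos _).le).trans hfin
  have h2 : Real.exp (-1) * Φ * ‖Δ‖ ≤ 2 * lam / (ξ + 1) * ξ :=
    le_of_mul_le_mul_right (by linarith) htT0
  have h3 : Real.exp 1 * Real.exp (-1) = 1 := by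
    rw [← Real.exp_add, add_neg_cancel, Real.exp_zero]
  rw [le_div_iff₀ (by positivity)]
  calc ‖Δ‖ * ((ξ + 1) * Φ) = (ξ + 1) * Real.exp 1 * (Real.exp (-1) * Φ * ‖Δ‖) := by
        linear_combination -(‖Δ‖ * ((ξ + 1) * Φ)) * h3
    _ ≤ (ξ + 1) * Real.exp 1 * (2 * lam / (ξ + 1) * ξ) :=
        mul_le_mul_of_nonneg_left h2 (by positivity)
    _ = 2 * Real.exp 1 * ξ * lam := by field_simp

/-- With no nonzero coordinates the Lasso recovers the true parameter. -/
theorem eq_zero_of_isMinOn [Nonempty K] (hv : ∀ k, 0 < v k)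
    (hgrad : ∀ i, |tiltedMean v X 0 (fun k => X k i) - a i| ≤ z) (hz : z < lam)
    (hlam : 0 ≤ lam) (hmin : IsMinOn (penalizedLoss v X a lam) Set.univ θhat) : θhat = 0 := by
  have h := tiltedMean_sub_le_of_isMinOn (T := ∅) hv hgrad hlam hmin (fun _ _ => rfl) le_rfl one_pos
  rw [zero_smul, add_zero, sub_self, Finset.sum_empty, mul_zero, zero_sub, Finset.compl_empty,
    sub_zero, neg_nonneg] at h
  have hs : ∑ i, |θhat i| = 0 :=
    le_antisymm (nonpos_of_mul_nonpos_right h (sub_pos.2 hz))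
      (Finset.sum_nonneg fun i _ => abs_nonneg _)
  ext i
  exact abs_eq_zero.1 ((Finset.sum_eq_zero_iff_of_nonneg fun i _ => abs_nonneg _).1 hs i
    (Finset.mem_univ i))

end Lasso

/-! ### The Hessian of the log-partition function as a covariance matrix. -/

section Hessian

variable {ι K : Type*} [Fintype ι] [Fintype K] {v : K → ℝ} {X : K → ι → ℝ}

/-- The linear functional given by the dot product with `u`. -/
noncomputable def dotCLM (u : ι → ℝ) : (ι → ℝ) →L[ℝ] ℝ :=
  ∑ i, u i • ContinuousLinearMap.proj (R := ℝ) (φ := fun _ : ι => ℝ) i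

theorem dotCLM_apply (u θ : ι → ℝ) : dotCLM u θ = θ ⬝ᵥ u := by
  simp [dotCLM, dotProduct, mul_comm]

theorem dotCLM_single [DecidableEq ι] (u : ι → ℝ) (j : ι) : dotCLM u (Pi.single j 1) = u j := by
  rw [dotCLM_apply, single_one_dotProduct]

theorem hasFDerivAt_sum_exp (c : K → ℝ) (X : K → ι → ℝ) (θ : ι → ℝ) :
    HasFDerivAt (fun θ : ι → ℝ => ∑ k, c k * Real.exp (θ ⬝ᵥ X k))
      (∑ k, (c k * Real.exp (θ ⬝ᵥ X k)) • dotCLM (X k)) θ := by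
  refine HasFDerivAt.fun_sum fun k _ => ?_
  have h := ((dotCLM (X k)).hasFDerivAt (x := θ)).exp.const_mul (c k)
  simp only [dotCLM_apply, smul_smul] at h
  exact h

theorem fderiv_logPartition_single [Nonempty K] [DecidableEq ι] (hv : ∀ k, 0 < v k) (θ : ι → ℝ) (j : ι) :
    fderiv ℝ (logPartition v X) θ (Pi.single j 1) = tiltedMean v X θ fun k => X k j := by
  have h := (hasFDerivAt_sum_exp v X θ).log (partition_pos hv θ).ne'
  change HasFDerivAt (logPartition v X) _ θ at h
  rw [h.fderiv]
  simp only [smul_apply, sum_apply, dotCLM_single,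
    smul_eq_mul, tiltedMean]
  rw [div_eq_inv_mul]

theorem hessian_logPartition [Nonempty K] [DecidableEq ι] (hv : ∀ k, 0 < v k) (θ : ι → ℝ) (i j : ι) :
    hessian (logPartition v X) θ i j = tiltedMean v X θ (fun k => X k i * X k j) -
      tiltedMean v X θ (fun k => X k i) * tiltedMean v X θ fun k => X k j := by
  simp only [hessian, Matrix.of_apply, fderiv_logPartition_single hv]
  have hZ := (partition_pos (X := X) hv θ).ne'
  have h1 := hasFDerivAt_sum_exp (fun k => v k * X k j) X θ
  have h2 := hasFDerivAt_sum_exp v X θ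
  have h3 := h1.mul ((hasDerivAt_inv hZ).comp_hasFDerivAt θ h2)
  have e : (fun θ' => tiltedMean v X θ' fun k => X k j) =
      fun θ' => (∑ k, v k * X k j * Real.exp (θ' ⬝ᵥ X k)) *
        (∑ k, v k * Real.exp (θ' ⬝ᵥ X k))⁻¹ := by
    ext θ'
    rw [tiltedMean, div_eq_mul_inv]
    congr 1
    exact Finset.sum_congr rfl fun k _ => by ring
  rw [e]
  refine (congrArg (fun L : (ι → ℝ) →L[ℝ] ℝ => L (Pi.single i 1)) h3.fderiv).trans ?_
  simp only [add_apply, smul_apply,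
    sum_apply, dotCLM_single, smul_eq_mul, tiltedMean, Function.comp_apply]
  have e1 : ∑ k, v k * X k j * Real.exp (θ ⬝ᵥ X k) * X k i =
      ∑ k, v k * Real.exp (θ ⬝ᵥ X k) * (X k i * X k j) :=
    Finset.sum_congr rfl fun k _ => by ring
  have e2 : ∑ k, v k * X k j * Real.exp (θ ⬝ᵥ X k) = ∑ k, v k * Real.exp (θ ⬝ᵥ X k) * X k j :=
    Finset.sum_congr rfl fun k _ => by ring
  rw [e1, e2]
  field_simp
  ring

theorem dotProduct_hessian_mulVec [Nonempty K] [DecidableEq ι] (hv : ∀ k, 0 < v k) (θ b : ι → ℝ) :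
    b ⬝ᵥ (hessian (logPartition v X) θ).mulVec b = tiltedVariance v X θ b := by
  rw [tiltedVariance_eq_sum]
  simp only [dotProduct, Matrix.mulVec, Finset.mul_sum, hessian_logPartition hv]
  exact Finset.sum_congr rfl fun i _ => Finset.sum_congr rfl fun j _ => by ring

end Hessian

/-! ### The Ising model and its Gibbs sampler. -/

section Ising

variable {d : ℕ}

theorem abs_J (y : Config d) (p : Pair d) : |J y p| = 1 := by
  have h : ∀ u : ℤˣ, |((u : ℤ) : ℝ)| = 1 := fun u => by
    rcases Int.units_eq_one_or u with rfl | rfl <;> simp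
  rw [J, abs_mul, h, h, one_mul]

theorem normConst_pos (θ : Param d) : 0 < normConst θ :=
  Finset.sum_pos (fun _ _ => Real.exp_pos _) Finset.univ_nonempty

theorem isingDensity_pos (θ : Param d) (y : Config d) : 0 < isingDensity θ y :=
  div_pos (Real.exp_pos _) (normConst_pos θ)

theorem sum_isingDensity (θ : Param d) : ∑ y, isingDensity θ y = 1 := by
  simp only [isingDensity, ← Finset.sum_div]
  exact div_self (normConst_pos θ).ne'

theorem log_normConst_eq_logPartition :
    (fun θ : Param d => Real.log (normConst θ)) = logPartition (fun _ => 1) J := by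
  ext θ
  simp [normConst, logPartition]

theorem sum_isingDensity_mul (θ : Param d) (g : Config d → ℝ) :
    ∑ y, isingDensity θ y * g y = tiltedMean (fun _ => 1) J θ g := by
  simp only [isingDensity, tiltedMean, one_mul, Finset.sum_div, normConst]
  exact Finset.sum_congr rfl fun y _ => by ring

theorem numParam_eq_card (d : ℕ) : numParam d = Fintype.card (Pair d) := by
  have h : Fintype.card (Pair d) * 2 = d * (d - 1) := by
    have e : Pair d ≃ Σ i : Fin d, {j : Fin d // j < i} :=
      { toFun := fun p => ⟨p.1.2, ⟨p.1.1, p.2⟩⟩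
        invFun := fun s => ⟨(s.2.1, s.1), s.2.2⟩
        left_inv := fun _ => rfl
        right_inv := fun _ => rfl }
    rw [Fintype.card_congr e, Fintype.card_sigma, ← Finset.sum_range_id_mul_two,
      Finset.sum_range]
    congr 1
    refine Finset.sum_congr rfl fun i _ => ?_
    rw [Fintype.card_subtype]
    exact (Finset.filter_gt_eq_Iio (a := i) ▸ Fin.card_Iio i)
  have h2 : (Fintype.card (Pair d) : ℝ) * 2 = d * ((d : ℝ) - 1) := by
    rcases Nat.eq_zero_or_pos d with rfl | hd
    · simp
    · rw [← Nat.cast_pred hd]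
      exact_mod_cast h
  rw [numParam, ← h2]
  ring

theorem sum_units (f : ℤˣ → ℝ) : ∑ s, f s = f 1 + f (-1) := by
  rw [show (Finset.univ : Finset ℤˣ) = {1, -1} from by decide, Finset.sum_pair (by decide)]

/-- The total weight of the two configurations that agree with `y` off `r`. -/
noncomputable def siteWeight (ψ : Param d) (y : Config d) (r : Fin d) : ℝ :=
  Real.exp (ψ ⬝ᵥ J (Function.update y r 1)) + Real.exp (ψ ⬝ᵥ J (Function.update y r (-1)))

theorem siteWeight_pos (ψ : Param d) (y : Config d) (r : Fin d) : 0 < siteWeight ψ y r :=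
  add_pos (Real.exp_pos _) (Real.exp_pos _)

theorem siteWeight_update (ψ : Param d) (y : Config d) (r : Fin d) (s : ℤˣ) :
    siteWeight ψ (Function.update y r s) r = siteWeight ψ y r := by
  simp [siteWeight]

theorem gibbsMatrix_apply (ψ : Param d) (y y' : Config d) :
    gibbsMatrix ψ y y' = (1 / (d : ℝ)) * ∑ r : Fin d, ∑ s : ℤˣ,
      if y' = Function.update y r s then
        Real.exp (ψ ⬝ᵥ J (Function.update y r s)) / siteWeight ψ y r else 0 := rfl

theorem gibbsMatrix_nonneg (ψ : Param d) (y y' : Config d) : 0 ≤ gibbsMatrix ψ y y' := by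
  rw [gibbsMatrix_apply]
  refine mul_nonneg (by positivity) (Finset.sum_nonneg fun r _ => Finset.sum_nonneg fun s _ => ?_)
  split_ifs
  · exact div_nonneg (Real.exp_pos _).le (siteWeight_pos _ _ _).le
  · exact le_rfl

theorem gibbsMatrix_mulVec (ψ : Param d) (g : Config d → ℝ) (y : Config d) :
    (gibbsMatrix ψ).mulVec g y = (1 / (d : ℝ)) * ∑ r : Fin d, ∑ s : ℤˣ,
      Real.exp (ψ ⬝ᵥ J (Function.update y r s)) / siteWeight ψ y r *
        g (Function.update y r s) := by
  simp only [Matrix.mulVec, dotProduct, gibbsMatrix_apply, mul_assoc, ← Finset.mul_sum,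
    Finset.sum_mul]
  congr 1
  rw [Finset.sum_comm]
  refine Finset.sum_congr rfl fun r _ => ?_
  rw [Finset.sum_comm]
  refine Finset.sum_congr rfl fun s _ => ?_
  simp [ite_mul]

theorem sum_siteWeight (ψ : Param d) (y : Config d) (r : Fin d) :
    ∑ s : ℤˣ, Real.exp (ψ ⬝ᵥ J (Function.update y r s)) / siteWeight ψ y r = 1 := by
  rw [← Finset.sum_div, sum_units]
  exact div_self (siteWeight_pos ψ y r).ne'

theorem sum_gibbsMatrix (hd : 0 < d) (ψ : Param d) (y : Config d) :
    ∑ y', gibbsMatrix ψ y y' = 1 := by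
  have h := gibbsMatrix_mulVec ψ (fun _ => 1) y
  simp only [mul_one, sum_siteWeight] at h
  have e : (gibbsMatrix ψ).mulVec (fun _ => 1) y = ∑ y', gibbsMatrix ψ y y' := by
    simp [Matrix.mulVec, dotProduct]
  rw [← e, h]
  have : (d : ℝ) ≠ 0 := by positivity
  simp [this]

theorem gibbsMatrix_diag_pos (hd : 0 < d) (ψ : Param d) (y : Config d) :
    0 < gibbsMatrix ψ y y := by
  rw [gibbsMatrix_apply]
  have hnn : ∀ (r : Fin d) (s : ℤˣ), 0 ≤ if y = Function.update y r s then
      Real.exp (ψ ⬝ᵥ J (Function.update y r s)) / siteWeight ψ y r else 0 := fun r s => by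
    split_ifs
    · exact div_nonneg (Real.exp_pos _).le (siteWeight_pos _ _ _).le
    · exact le_rfl
  refine mul_pos (by positivity) ?_
  refine Finset.sum_pos' (fun r _ => Finset.sum_nonneg fun s _ => hnn r s)
    ⟨⟨0, hd⟩, Finset.mem_univ _, Finset.sum_pos' (fun s _ => hnn _ s)
      ⟨y ⟨0, hd⟩, Finset.mem_univ _, ?_⟩⟩
  rw [if_pos (Function.update_eq_self _ _).symm]
  exact div_pos (Real.exp_pos _) (siteWeight_pos _ _ _)

/-- The random scan Gibbs sampler is reversible. -/
theorem isingDensity_mul_gibbsMatrix (ψ : Param d) (y y' : Config d) :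
    isingDensity ψ y * gibbsMatrix ψ y y' = isingDensity ψ y' * gibbsMatrix ψ y' y := by
  have hsite : ∀ (y y' : Config d) (r : Fin d),
      (∑ s : ℤˣ, if y' = Function.update y r s then
        Real.exp (ψ ⬝ᵥ J (Function.update y r s)) / siteWeight ψ y r else 0) =
      if y' = Function.update y r (y' r) then Real.exp (ψ ⬝ᵥ J y') / siteWeight ψ y r else 0 := by
    intro y y' r
    rw [Finset.sum_eq_single_of_mem (y' r) (Finset.mem_univ _)]
    · split_ifs with h
      · rw [← h]
      · rfl
    · intro s _ hs
      refine if_neg fun h => hs ?_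
      rw [h, Function.update_self]
  simp only [gibbsMatrix_apply, hsite, Finset.mul_sum]
  refine Finset.sum_congr rfl fun r _ => ?_
  -- If y and y' agree off r, both directions carry exp(ψ'J(y))·exp(ψ'J(y')) over the same site
  -- weight.
  by_cases h : y' = Function.update y r (y' r)
  · have h' : y = Function.update y' r (y r) := by
      rw [h, Function.update_idem, Function.update_eq_self]
    have hw : siteWeight ψ y' r = siteWeight ψ y r := by
      rw [h, siteWeight_update]
    rw [if_pos h, if_pos h', hw, isingDensity, isingDensity]
    ring
  · have h' : ¬ y = Function.update y' r (y r) := fun h' => h (by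
      rw [h', Function.update_idem, Function.update_eq_self])
    rw [if_neg h, if_neg h']
    simp

/-- The random scan Gibbs sampler is irreducible. -/
theorem eq_of_gibbsMatrix_mulVec_eq (hd : 0 < d) {ψ : Param d} {g : Config d → ℝ}
    (hg : (gibbsMatrix ψ).mulVec g = g) (y y' : Config d) : g y = g y' := by
  obtain ⟨x, -, hx⟩ := Finset.exists_max_image Finset.univ g Finset.univ_nonempty
  -- Maximum principle: where `g` is maximal it equals an average with positive weights over
  -- one-site updates, so these are maximal too. Updating sites one at a time reaches every
  -- configuration.
  have hstep : ∀ u, g u = g x → ∀ r s, g (Function.update u r s) = g x := by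
    intro u hu
    have h1 := congrFun hg u
    rw [gibbsMatrix_mulVec] at h1
    have h2 : ∑ r : Fin d, ∑ s : ℤˣ,
        Real.exp (ψ ⬝ᵥ J (Function.update u r s)) / siteWeight ψ u r *
          (g x - g (Function.update u r s)) = 0 := by
      simp only [mul_sub, Finset.sum_sub_distrib, ← Finset.sum_mul, sum_siteWeight]
      have hd' : (d : ℝ) ≠ 0 := by positivity
      rw [one_div, inv_mul_eq_iff_eq_mul₀ hd', hu] at h1
      rw [h1]
      simp
    have hc : ∀ r s, 0 < Real.exp (ψ ⬝ᵥ J (Function.update u r s)) / siteWeight ψ u r :=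
      fun r s => div_pos (Real.exp_pos _) (siteWeight_pos _ _ _)
    have hnn : ∀ r s, 0 ≤ Real.exp (ψ ⬝ᵥ J (Function.update u r s)) / siteWeight ψ u r *
        (g x - g (Function.update u r s)) :=
      fun r s => mul_nonneg (hc r s).le (sub_nonneg.2 (hx _ (Finset.mem_univ _)))
    intro r s
    have h3 := (Finset.sum_eq_zero_iff_of_nonneg fun r _ =>
      Finset.sum_nonneg fun s _ => hnn r s).1 h2 r (Finset.mem_univ r)
    have h4 := (Finset.sum_eq_zero_iff_of_nonneg fun s _ => hnn r s).1 h3 s (Finset.mem_univ s)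
    have h5 := (mul_eq_zero.1 h4).resolve_left (hc r s).ne'
    linarith
  have hall : ∀ (z : Config d) (A : Finset (Fin d)), g (A.piecewise z x) = g x := by
    intro z A
    induction A using Finset.induction_on with
    | empty => rw [Finset.piecewise_empty]
    | insert j A _ ih =>
      rw [Finset.piecewise_insert]
      exact hstep _ ih _ _
  have h := fun z => hall z Finset.univ
  simp only [Finset.piecewise_univ] at h
  rw [h y, h y']

theorem kappa_gibbsMatrix_lt_one (hd : 0 < d) (ψ : Param d) : kappa (gibbsMatrix ψ) < 1 :=
  kappa_lt_one (gibbsMatrix_nonneg ψ) (sum_gibbsMatrix hd ψ) (gibbsMatrix_diag_pos hd ψ)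

theorem beta2_pos (hd : 0 < d) (ψ : Param d) : 0 < beta2 ψ :=
  div_pos (sub_pos.2 (kappa_gibbsMatrix_lt_one hd ψ))
    (by linarith [kappa_nonneg (gibbsMatrix ψ)])

/-- The ratio q/h has mean 1 under h, hence second moment at least 1. -/
theorem one_le_beta1 {q : Config d → ℝ} (hq : ∑ y, q y = 1) (ψ : Param d) :
    1 ≤ beta1 q (isingDensity ψ) := by
  have h := sq_sum_mul_mul_le (fun y => (isingDensity_pos ψ y).le)
    (fun y => q y / isingDensity ψ y) fun _ => 1
  have e1 : ∑ y, isingDensity ψ y * (q y / isingDensity ψ y * 1) = 1 := by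
    refine (Finset.sum_congr rfl fun y _ => ?_).trans hq
    field_simp [(isingDensity_pos ψ y).ne']
  have e2 : ∑ y, isingDensity ψ y * (q y / isingDensity ψ y) ^ 2 =
      ∑ y, q y ^ 2 / isingDensity ψ y :=
    Finset.sum_congr rfl fun y _ => by field_simp [(isingDensity_pos ψ y).ne']
  rw [e1, e2] at h
  simp only [one_pow, mul_one, sum_isingDensity] at h
  exact Real.one_le_sqrt.2 h

end Ising

/-! ### Concentration of the data mean and of the Monte Carlo moments. -/

section Concentration

variable {d : ℕ}

/-- Importance weights of the states of the chain. -/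
noncomputable def chainWeight (m : ℕ) (ψ : Param d) (z : ℕ → Config d) (k : Fin m) : ℝ :=
  1 / (m * isingDensity ψ (z k))

/-- The importance sampling approximation of the mean of `g` under the Ising model at `θ`. -/
noncomputable def chainMean (m : ℕ) (ψ : Param d) (z : ℕ → Config d) (θ : Param d)
    (g : Config d → ℝ) : ℝ :=
  tiltedMean (chainWeight m ψ z) (fun k => J (z k)) θ fun k => g (z k)

/-- The mean of `g` under the Ising model at `θ`. -/
noncomputable def isingMean (θ : Param d) (g : Config d → ℝ) : ℝ :=
  tiltedMean (fun _ => 1) J θ g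

/-- The empirical mean of the statistics. -/
noncomputable def sampleMean {n : ℕ} (y : Fin n → Config d) : Param d :=
  fun p => (1 / (n : ℝ)) * ∑ i, J (y i) p

theorem chainWeight_pos {m : ℕ} (hm : 0 < m) (ψ : Param d) (z : ℕ → Config d) (k : Fin m) :
    0 < chainWeight m ψ z k :=
  one_div_pos.2 (mul_pos (Nat.cast_pos.2 hm) (isingDensity_pos ψ _))

/-- Places the random objective within the scope of the deterministic analysis: each state of the
chain, repetitions included, is an atom of an exponential family. -/
theorem lassoObjective_eq_penalizedLoss {n m : ℕ} (ψ : Param d) (lam : ℝ)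
    (y : Fin n → Config d) (z : ℕ → Config d) :
    lassoObjective m (isingDensity ψ) lam y z =
      penalizedLoss (chainWeight m ψ z) (fun k => J (z k)) (sampleMean y) lam := by
  ext θ
  rw [lassoObjective, mcNegLogLik, penalizedLoss, logPartition]
  congr 2
  · simp only [sampleMean, dotProduct, Finset.mul_sum]
    rw [Finset.sum_comm, ← Finset.sum_neg_distrib]
    refine Finset.sum_congr rfl fun p _ => ?_
    rw [← Finset.sum_neg_distrib]
    exact Finset.sum_congr rfl fun i _ => by ring
  · rw [Finset.sum_range, Finset.mul_sum]
    congr 1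
    refine Finset.sum_congr rfl fun k _ => ?_
    rw [chainWeight, one_div_mul_eq_div, div_div, one_div_mul_eq_div, mul_comm]

variable {Ω : Type*} [MeasurableSpace Ω] {μ : Measure Ω} [IsProbabilityMeasure μ]

theorem integral_comp_eq_isingMean {θ : Param d} {Y : Ω → Config d} (hY : Measurable Y)
    (hlaw : ∀ y, μ.real {ω | Y ω = y} = isingDensity θ y) (g : Config d → ℝ) :
    ∫ ω, g (Y ω) ∂μ = isingMean θ g := by
  have hg : Measurable g := measurable_of_finite g
  have := Measure.isProbabilityMeasure_map (μ := μ) hY.aemeasurable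
  rw [← integral_map hY.aemeasurable hg.aestronglyMeasurable, integral_fintype (.of_finite),
    isingMean, ← sum_isingDensity_mul]
  refine Finset.sum_congr rfl fun y _ => ?_
  rw [map_measureReal_apply hY (measurableSet_singleton y), smul_eq_mul, ← hlaw]
  rfl

theorem measureReal_sum_sub_isingMean_ge_le {n : ℕ} {θ : Param d} {Y : Fin n → Ω → Config d}
    (hY : ∀ i, Measurable (Y i)) (hindep : iIndepFun Y μ)
    (hlaw : ∀ i y, μ.real {ω | Y i ω = y} = isingDensity θ y) {g : Config d → ℝ}
    (hg : ∀ y, |g y| ≤ 1) {t : ℝ} (ht : 0 ≤ t) :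
    μ.real {ω | n * t ≤ ∑ i, (g (Y i ω) - isingMean θ g)} ≤ Real.exp (-(n * t ^ 2 / 2)) := by
  have hgm : Measurable g := measurable_of_finite g
  have hsub : ∀ i ∈ (Finset.univ : Finset (Fin n)),
      HasSubgaussianMGF (fun ω => g (Y i ω) - isingMean θ g) 1 μ := fun i _ => by
    have h := hasSubgaussianMGF_of_mem_Icc (μ := μ) (X := fun ω => g (Y i ω)) (a := -1) (b := 1)
      (hgm.comp (hY i)).aemeasurable (ae_of_all _ fun ω => abs_le.1 (hg (Y i ω)))
    rw [integral_comp_eq_isingMean (hY i) (hlaw i)] at h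
    have e : (‖(1 : ℝ) - -1‖₊ / 2) ^ 2 = 1 := by
      ext
      norm_num
    rwa [e] at h
  have hind : iIndepFun (fun i ω => g (Y i ω) - isingMean θ g) μ :=
    hindep.comp (fun _ y => g y - isingMean θ g) fun _ => hgm.sub_const _
  have h := HasSubgaussianMGF.measure_sum_ge_le_of_iIndepFun hind hsub
    (mul_nonneg (Nat.cast_nonneg n) ht)
  refine h.trans (le_of_eq ?_)
  rcases Nat.eq_zero_or_pos n with rfl | hn
  · simp
  · have : (n : ℝ) ≠ 0 := by positivity
    simp only [Finset.sum_const, Finset.card_univ, Fintype.card_fin, nsmul_eq_mul, mul_one,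
      NNReal.coe_natCast]
    congr 1
    field_simp

theorem isingMean_neg (θ : Param d) (g : Config d → ℝ) :
    isingMean θ (fun y => -g y) = -isingMean θ g := by
  have h := tiltedMean_const_mul (fun _ => 1) J θ (-1) g
  simpa [isingMean] using h

theorem chainMean_neg (m : ℕ) (ψ : Param d) (z : ℕ → Config d) (θ : Param d)
    (g : Config d → ℝ) : chainMean m ψ z θ (fun y => -g y) = -chainMean m ψ z θ g := by
  have h := tiltedMean_const_mul (chainWeight m ψ z) (fun k => J (z k)) θ (-1) fun k => g (z k)
  simpa [chainMean] using h

/-- Hoeffding's inequality for the empirical mean of the independent sample. -/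
theorem measureReal_abs_sampleMean_sub_gt_le {n : ℕ} (hn : 0 < n) {θ : Param d}
    {Y : Fin n → Ω → Config d} (hY : ∀ i, Measurable (Y i)) (hindep : iIndepFun Y μ)
    (hlaw : ∀ i y, μ.real {ω | Y i ω = y} = isingDensity θ y) (p : Pair d) {t : ℝ} (ht : 0 ≤ t) :
    μ.real {ω | t < |sampleMean (fun i => Y i ω) p - isingMean θ fun y => J y p|} ≤
      2 * Real.exp (-(n * t ^ 2 / 2)) := by
  have hn' : (0 : ℝ) < n := Nat.cast_pos.2 hn
  have h1 := measureReal_sum_sub_isingMean_ge_le hY hindep hlaw (g := fun y => J y p)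
    (fun y => (abs_J y p).le) ht
  have h2 := measureReal_sum_sub_isingMean_ge_le hY hindep hlaw (g := fun y => -J y p)
    (fun y => by rw [abs_neg, abs_J]) ht
  rw [isingMean_neg] at h2
  rw [two_mul]
  refine le_trans (measureReal_mono ?_) ((measureReal_union_le _ _).trans (add_le_add h1 h2))
  intro ω hω
  simp only [Set.mem_ofPred_eq, Set.mem_union] at hω ⊢
  have e : n * (sampleMean (fun i => Y i ω) p - isingMean θ fun y => J y p) =
      ∑ i, (J (Y i ω) p - isingMean θ fun y => J y p) := by
    simp only [sampleMean, Finset.sum_sub_distrib, Finset.sum_const, Finset.card_univ,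
      Fintype.card_fin, nsmul_eq_mul]
    field_simp
  have e2 : ∑ i, (-J (Y i ω) p - -isingMean θ fun y => J y p) =
      -∑ i, (J (Y i ω) p - isingMean θ fun y => J y p) := by
    rw [← Finset.sum_neg_distrib]
    exact Finset.sum_congr rfl fun i _ => by ring
  rw [e2, ← e]
  rcases lt_abs.1 hω with h | h
  · exact Or.inl (mul_le_mul_of_nonneg_left h.le hn'.le)
  · refine Or.inr ?_
    rw [← mul_neg]
    exact mul_le_mul_of_nonneg_left h.le hn'.le

/-- Hoeffding's inequality for the importance sampling approximation along the Gibbs sampler. -/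
theorem measureReal_chainMean_sub_gt_le {m : ℕ} (hd : 0 < d) (hm : 0 < m) {θ ψ : Param d}
    {q : Config d → ℝ} (hq : ∀ y, 0 ≤ q y) {Z : ℕ → Ω → Config d}
    (hZ : IsMarkovChain μ q (gibbsMatrix ψ) m Z) {g : Config d → ℝ} (hg : ∀ y, |g y| ≤ 1)
    {τ : ℝ} (hτ : 0 < τ) :
    μ.real {ω | τ < chainMean m ψ (fun k => Z k ω) θ g - isingMean θ g} ≤
      beta1 q (isingDensity ψ) *
        Real.exp (-(beta2 ψ * m * τ ^ 2 / (16 * maxRatio θ (isingDensity ψ) ^ 2))) := by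
  set w : Config d → ℝ := fun y => Real.exp (θ ⬝ᵥ J y) / (isingDensity ψ y * normConst θ) with hw
  have hw0 : ∀ y, 0 ≤ w y := fun y =>
    div_nonneg (Real.exp_pos _).le (mul_pos (isingDensity_pos ψ y) (normConst_pos θ)).le
  have hwM : ∀ y, w y ≤ maxRatio θ (isingDensity ψ) := fun y =>
    Finset.le_sup' w (Finset.mem_univ y)
  have hhw : ∀ y, isingDensity ψ y * w y = isingDensity θ y := fun y => by
    have h1 := (isingDensity_pos ψ y).ne'
    rw [hw, show isingDensity θ y = Real.exp (θ ⬝ᵥ J y) / normConst θ from rfl]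
    field_simp
  have hw1 : ∑ y, isingDensity ψ y * w y = 1 := by
    simp only [hhw, sum_isingDensity]
  have hν : ∑ y, isingDensity ψ y * (w y * g y) = isingMean θ g := by
    simp only [← mul_assoc, hhw, sum_isingDensity_mul, isingMean]
  refine (measureReal_mono ?_).trans (hZ.ratio_tail hm hq (isingDensity_pos ψ) (sum_isingDensity ψ)
    (isingDensity_mul_gibbsMatrix ψ) (gibbsMatrix_nonneg ψ) (sum_gibbsMatrix hd ψ)
    (sum_mul_mulVec_sq_le (isingDensity_pos ψ) (isingDensity_mul_gibbsMatrix ψ)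
      fun g hg => eq_of_gibbsMatrix_mulVec_eq hd hg)
    (kappa_nonneg _) (kappa_gibbsMatrix_lt_one hd ψ) hw0 hwM hw1 hg hν hτ)
  intro ω hω
  simp only [Set.mem_ofPred_eq] at hω ⊢
  have hne : Nonempty (Fin m) := ⟨⟨0, hm⟩⟩
  have hpos := partition_pos (X := fun k : Fin m => J (Z k ω))
    (chainWeight_pos hm ψ fun k => Z k ω) θ
  -- Multiplying by the positive denominator turns the deviation of the ratio into positivity of a
  -- sum along the chain.
  rw [lt_sub_iff_add_lt, chainMean, tiltedMean, lt_div_iff₀ hpos, Finset.mul_sum, ← sub_pos,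
    ← Finset.sum_sub_distrib] at hω
  have e : ∑ k ∈ Finset.range m, w (Z k ω) * (g (Z k ω) - isingMean θ g - τ) =
      (m / normConst θ) * ∑ k : Fin m, (chainWeight m ψ (fun k => Z k ω) k *
        Real.exp (θ ⬝ᵥ J (Z k ω)) * g (Z k ω) - (τ + isingMean θ g) *
          (chainWeight m ψ (fun k => Z k ω) k * Real.exp (θ ⬝ᵥ J (Z k ω)))) := by
    rw [Finset.sum_range, Finset.mul_sum]
    refine Finset.sum_congr rfl fun k _ => ?_
    have h1 := (isingDensity_pos ψ (Z k ω)).ne'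
    have h2 := (normConst_pos θ).ne'
    have h3 : (m : ℝ) ≠ 0 := by positivity
    simp only [hw, chainWeight]
    field_simp
    ring
  rw [e]
  exact mul_pos (div_pos (Nat.cast_pos.2 hm) (normConst_pos θ)) hω

theorem measureReal_abs_chainMean_sub_gt_le {m : ℕ} (hd : 0 < d) (hm : 0 < m) {θ ψ : Param d}
    {q : Config d → ℝ} (hq : ∀ y, 0 ≤ q y) {Z : ℕ → Ω → Config d}
    (hZ : IsMarkovChain μ q (gibbsMatrix ψ) m Z) {g : Config d → ℝ} (hg : ∀ y, |g y| ≤ 1)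
    {τ : ℝ} (hτ : 0 < τ) :
    μ.real {ω | τ < |chainMean m ψ (fun k => Z k ω) θ g - isingMean θ g|} ≤
      2 * (beta1 q (isingDensity ψ) *
        Real.exp (-(beta2 ψ * m * τ ^ 2 / (16 * maxRatio θ (isingDensity ψ) ^ 2)))) := by
  have h1 := measureReal_chainMean_sub_gt_le hd hm hq hZ hg hτ (θ := θ)
  have h2 := measureReal_chainMean_sub_gt_le hd hm hq hZ (g := fun y => -g y)
    (fun y => by rw [abs_neg]; exact hg y) hτ (θ := θ)
  rw [two_mul]
  refine le_trans (measureReal_mono ?_) ((measureReal_union_le _ _).trans (add_le_add h1 h2))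
  intro ω hω
  simp only [Set.mem_ofPred_eq, Set.mem_union, isingMean_neg, chainMean_neg] at hω ⊢
  rcases lt_abs.1 hω with h | h
  · exact Or.inl h
  · exact Or.inr (by linarith)

theorem one_le_maxRatio (θ ψ : Param d) : 1 ≤ maxRatio θ (isingDensity ψ) := by
  have h : ∀ y, isingDensity θ y ≤ isingDensity ψ y * maxRatio θ (isingDensity ψ) := fun y => by
    have h1 := Finset.le_sup' (fun y : Config d => Real.exp (θ ⬝ᵥ J y) /
      (isingDensity ψ y * normConst θ)) (Finset.mem_univ y)
    have h2 : isingDensity θ y = isingDensity ψ y *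
        (Real.exp (θ ⬝ᵥ J y) / (isingDensity ψ y * normConst θ)) := by
      have h3 := (isingDensity_pos ψ y).ne'
      rw [show isingDensity θ y = Real.exp (θ ⬝ᵥ J y) / normConst θ from rfl]
      field_simp
    rw [h2]
    exact mul_le_mul_of_nonneg_left h1 (isingDensity_pos ψ y).le
  calc 1 = ∑ y, isingDensity θ y := (sum_isingDensity θ).symm
    _ ≤ ∑ y, isingDensity ψ y * maxRatio θ (isingDensity ψ) := Finset.sum_le_sum fun y _ => h y
    _ = maxRatio θ (isingDensity ψ) := by rw [← Finset.sum_mul, sum_isingDensity, one_mul]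

end Concentration

/-! ### Cone factor of the Monte Carlo Hessian and exact selection. -/

section Selection

theorem abs_sum_sum_mul_le {ι : Type*} [Fintype ι] {A B : ι → ι → ℝ} {η : ℝ}
    (h : ∀ i j, |A i j - B i j| ≤ η) (b : ι → ℝ) :
    |∑ i, ∑ j, b i * b j * A i j - ∑ i, ∑ j, b i * b j * B i j| ≤ η * (∑ i, |b i|) ^ 2 := by
  rw [← Finset.sum_sub_distrib, sq, Finset.sum_mul_sum, Finset.mul_sum]
  refine (Finset.abs_sum_le_sum_abs _ _).trans (Finset.sum_le_sum fun i _ => ?_)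
  rw [← Finset.sum_sub_distrib, Finset.mul_sum]
  refine (Finset.abs_sum_le_sum_abs _ _).trans (Finset.sum_le_sum fun j _ => ?_)
  rw [← mul_sub, abs_mul, abs_mul, mul_comm]
  exact mul_le_mul_of_nonneg_right (h i j) (by positivity)

theorem abs_cov_sub_cov_le {s s' x x' y y' r : ℝ} (hs : |s - s'| ≤ r) (hx : |x - x'| ≤ r)
    (hy : |y - y'| ≤ r) (hy1 : |y| ≤ 1) (hx1 : |x'| ≤ 1) :
    |(s - x * y) - (s' - x' * y')| ≤ 3 * r := by
  have e : (s - x * y) - (s' - x' * y') = (s - s') + (-((x - x') * y) + -(x' * (y - y'))) := by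
    ring
  have h1 : |(x - x') * y| ≤ r := by
    rw [abs_mul]
    exact (mul_le_of_le_one_right (abs_nonneg _) hy1).trans hx
  have h2 : |x' * (y - y')| ≤ r := by
    rw [abs_mul]
    exact (mul_le_of_le_one_left (abs_nonneg _) hx1).trans hy
  rw [e]
  have h3 := abs_add_le (s - s') (-((x - x') * y) + -(x' * (y - y')))
  have h4 := abs_add_le (-((x - x') * y)) (-(x' * (y - y')))
  rw [abs_neg, abs_neg] at h4
  linarith

theorem two_lt_alpha {ξ : ℝ} (hξ : 1 < ξ) : 2 < alpha ξ := by
  have : 0 < Real.exp 1 / (ξ - 1) := div_pos (Real.exp_pos 1) (by linarith)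
  rw [alpha]
  linarith

variable {d : ℕ} {θs ψ : Param d} {ξ : ℝ}

theorem hessian_log_normConst_quadratic (θ b : Param d) :
    b ⬝ᵥ (hessian (fun θ' : Param d => Real.log (normConst θ')) θ).mulVec b =
      tiltedVariance (fun _ => 1) J θ b := by
  rw [log_normConst_eq_logPartition, dotProduct_hessian_mulVec fun _ => one_pos]

/-- `ENNReal.ofReal` truncates negative quotients to 0 and division by 0 gives 0; positivity of the
factor excludes both. -/
theorem trueFactor_toReal_mul_le (hF : 0 < (trueFactor ξ θs).toReal) {b : Param d} (hb : b ≠ 0)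
    (hcone : b ∈ cone ξ (supp θs)) :
    (trueFactor ξ θs).toReal * (l1On (supp θs) b * ‖b‖) ≤
      tiltedVariance (fun _ => 1) J θs b := by
  have h : trueFactor ξ θs ≤ ENNReal.ofReal (tiltedVariance (fun _ => 1) J θs b /
      (l1On (supp θs) b * ‖b‖)) := by
    rw [← hessian_log_normConst_quadratic]
    exact iInf₂_le b ⟨hb, hcone⟩
  have h1 := ENNReal.toReal_mono ENNReal.ofReal_ne_top h
  have h2 : 0 < tiltedVariance (fun _ => 1) J θs b / (l1On (supp θs) b * ‖b‖) := by
    by_contra hneg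
    rw [ENNReal.ofReal_eq_zero.2 (not_lt.1 hneg), ENNReal.toReal_zero] at h1
    linarith
  rw [ENNReal.toReal_ofReal h2.le] at h1
  have h3 : 0 ≤ l1On (supp θs) b * ‖b‖ :=
    mul_nonneg (Finset.sum_nonneg fun _ _ => abs_nonneg _) (norm_nonneg _)
  rcases h3.eq_or_lt with h4 | h4
  · rw [← h4, div_zero] at h2
    exact absurd h2 (lt_irrefl 0)
  · exact (le_div_iff₀ h4).1 h1

/-- A coordinate vector on T lies in the cone, so the infimum is over a nonempty set of finite
values. -/
theorem trueFactor_ne_top (hξ : 1 < ξ) (hT : (supp θs).Nonempty) : trueFactor ξ θs ≠ ⊤ := by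
  obtain ⟨p, hp⟩ := hT
  refine ne_top_of_le_ne_top ?_ (iInf₂_le (Pi.single p 1) ⟨?_, ?_⟩)
  · exact ENNReal.ofReal_ne_top
  · exact fun h => one_ne_zero (α := ℝ) (by simpa using congrFun h p)
  · have h1 : l1On (supp θs)ᶜ (Pi.single p 1 : Param d) = 0 :=
      Finset.sum_eq_zero fun i hi => by
        have : i ≠ p := fun h => Finset.mem_compl.1 hi (h ▸ hp)
        simp [this]
    change l1On (supp θs)ᶜ (Pi.single p 1 : Param d) ≤ _
    rw [h1]
    exact mul_nonneg (by linarith) (Finset.sum_nonneg fun _ _ => abs_nonneg _)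

/-- The cone invertibility factor of the Monte Carlo Hessian. -/
theorem factor_mul_le_tiltedVariance {K : Type*} [Fintype K] [Nonempty K] {v : K → ℝ}
    {X : K → Param d} (hv : ∀ k, 0 < v k) (hX : ∀ k i, |X k i| ≤ 1) (hξ : 1 < ξ)
    (hF : 0 < (trueFactor ξ θs).toReal) {r : ℝ}
    (hr : 3 * r * ((1 + ξ) ^ 2 * (supp θs).card) ≤ 2 / alpha ξ * (trueFactor ξ θs).toReal)
    (hr0 : 0 ≤ r)
    (h1 : ∀ p, |tiltedMean v X θs (fun k => X k p) - isingMean θs fun y => J y p| ≤ r)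
    (h2 : ∀ p p', |tiltedMean v X θs (fun k => X k p * X k p') -
      isingMean θs fun y => J y p * J y p'| ≤ r)
    {b : Param d} (hb : b ≠ 0) (hcone : b ∈ cone ξ (supp θs)) :
    (trueFactor ξ θs).toReal * ((alpha ξ - 2) / alpha ξ) * (l1On (supp θs) b * ‖b‖) ≤
      tiltedVariance v X θs b := by
  set Fr := (trueFactor ξ θs).toReal with hFr
  have hα := two_lt_alpha hξ
  have h3 := trueFactor_toReal_mul_le hF hb hcone
  have h4 := abs_sum_sum_mul_le (η := 3 * r)
    (A := fun p p' => tiltedMean v X θs (fun k => X k p * X k p') -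
      tiltedMean v X θs (fun k => X k p) * tiltedMean v X θs fun k => X k p')
    (B := fun p p' => isingMean θs (fun y => J y p * J y p') -
      isingMean θs (fun y => J y p) * isingMean θs fun y => J y p')
    (fun p p' => abs_cov_sub_cov_le (h2 p p') (h1 p) (h1 p')
      (abs_tiltedMean_le hv θs fun k => hX k p')
      (abs_tiltedMean_le (fun _ => one_pos) θs fun y => (abs_J y p).le)) b
  rw [← tiltedVariance_eq_sum] at h4
  have h5 : ∑ i, ∑ j, b i * b j * (isingMean θs (fun y => J y i * J y j) -
      isingMean θs (fun y => J y i) * isingMean θs fun y => J y j) =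
      tiltedVariance (fun _ => 1) J θs b := (tiltedVariance_eq_sum _ _ _ _).symm
  rw [h5] at h4
  set t := l1On (supp θs) b with ht
  have ht0 : 0 ≤ t := Finset.sum_nonneg fun _ _ => abs_nonneg _
  have hl1 : ∑ i, |b i| ≤ (1 + ξ) * t := by
    have hc : l1On (supp θs)ᶜ b ≤ ξ * t := hcone
    rw [← Finset.sum_add_sum_compl (supp θs)]
    change t + l1On (supp θs)ᶜ b ≤ _
    linarith
  have htc : t ≤ (supp θs).card * ‖b‖ := by
    rw [ht, l1On, ← nsmul_eq_mul]
    exact Finset.sum_le_card_nsmul _ _ _ fun i _ => norm_le_pi_norm b i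
  -- On the cone |b|₁² ≤ (1+ξ)²|b_T|₁², and one factor |b_T|₁ is traded for |T|·|b|_∞. The
  -- perturbation thus has the same form as the cone bound.
  have h6 : 3 * r * (∑ i, |b i|) ^ 2 ≤ 2 / alpha ξ * Fr * (t * ‖b‖) := by
    calc 3 * r * (∑ i, |b i|) ^ 2 ≤ 3 * r * ((1 + ξ) * t) ^ 2 := by
          refine mul_le_mul_of_nonneg_left ?_ (by positivity)
          exact pow_le_pow_left₀ (Finset.sum_nonneg fun _ _ => abs_nonneg _) hl1 2
      _ = 3 * r * (1 + ξ) ^ 2 * t * t := by ring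
      _ ≤ 3 * r * (1 + ξ) ^ 2 * t * ((supp θs).card * ‖b‖) :=
          mul_le_mul_of_nonneg_left htc (by positivity)
      _ = 3 * r * ((1 + ξ) ^ 2 * (supp θs).card) * (t * ‖b‖) := by ring
      _ ≤ _ := mul_le_mul_of_nonneg_right hr (by positivity)
  have h7 : Fr * ((alpha ξ - 2) / alpha ξ) * (t * ‖b‖) =
      Fr * (t * ‖b‖) - 2 / alpha ξ * Fr * (t * ‖b‖) := by
    have : alpha ξ ≠ 0 := by linarith
    field_simp
  rw [h7]
  have h8 := (abs_le.1 h4).1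
  linarith

theorem thresholdSupp_eq_of_norm_sub_le {δ : ℝ} {θhat : Param d} (h : ‖θhat - θs‖ ≤ δ)
    (hδ : 0 < δ) (hmin : ENNReal.ofReal δ < thetaMin θs / 2) :
    thresholdSupp δ θhat = supp θs := by
  ext p
  simp only [thresholdSupp, supp, Finset.mem_filter, Finset.mem_univ, true_and]
  have hp : |θhat p - θs p| ≤ δ := (norm_le_pi_norm (θhat - θs) p).trans h
  constructor
  · intro h1 h0
    rw [h0, sub_zero] at hp
    linarith
  · intro h0
    have hmem : p ∈ supp θs := by simp [supp, h0]
    have h1 : thetaMin θs ≤ ENNReal.ofReal |θs p| := iInf₂_le p hmem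
    have h2 : ENNReal.ofReal δ < ENNReal.ofReal (|θs p| / 2) := by
      rw [ENNReal.ofReal_div_of_pos two_pos, ENNReal.ofReal_ofNat]
      exact hmin.trans_le (ENNReal.div_le_div_right h1 2)
    have h3 := (ENNReal.ofReal_lt_ofReal_iff_of_nonneg hδ.le).1 h2
    have h4 := abs_sub_abs_le_abs_sub (θs p) (θhat p)
    rw [abs_sub_comm] at h4
    linarith

/-- Correct selection on the event that all the averages are close to their means. -/
theorem thresholdSupp_eq_supp {n m : ℕ} (hm : 0 < m) {y : Fin n → Config d} {z : ℕ → Config d}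
    {lam δ r : ℝ} (hξ : 1 < ξ) (hδ : 0 < δ) (hlam : 0 < lam) {θhat : Param d}
    (hθhat : (∃ θ, IsMinOn (lassoObjective m (isingDensity ψ) lam y z) Set.univ θ) →
      IsMinOn (lassoObjective m (isingDensity ψ) lam y z) Set.univ θhat)
    (hgrad : ∀ p, |chainMean m ψ z θs (fun y => J y p) - sampleMean y p| ≤
      (ξ - 1) / (ξ + 1) * lam)
    (hδ_lt : ENNReal.ofReal δ < thetaMin θs / 2)
    (hδ_ge : errorBound ξ lam (trueFactor ξ θs) ≤ ENNReal.ofReal δ)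
    (hT : (supp θs).Nonempty → 0 < (trueFactor ξ θs).toReal ∧ 0 ≤ r ∧
      3 * r * ((1 + ξ) ^ 2 * (supp θs).card) ≤ 2 / alpha ξ * (trueFactor ξ θs).toReal ∧
      lam * (ξ + 1) * (supp θs).card ≤
        Real.exp (-1) * ((trueFactor ξ θs).toReal * ((alpha ξ - 2) / alpha ξ)) ∧
      (∀ p, |chainMean m ψ z θs (fun y => J y p) - isingMean θs fun y => J y p| ≤ r) ∧
      ∀ p p', |chainMean m ψ z θs (fun y => J y p * J y p') -
        isingMean θs fun y => J y p * J y p'| ≤ r) :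
    thresholdSupp δ θhat = supp θs := by
  have hne : Nonempty (Fin m) := ⟨⟨0, hm⟩⟩
  have hv := chainWeight_pos hm ψ z
  have hX : ∀ (k : Fin m) p, |J (z k) p| ≤ 1 := fun k p => (abs_J _ p).le
  have hξ1 : 0 < ξ + 1 := by linarith
  have hz0 : 0 ≤ (ξ - 1) / (ξ + 1) * lam :=
    mul_nonneg (div_nonneg (by linarith) hξ1.le) hlam.le
  have hz1 : (ξ - 1) / (ξ + 1) * lam < lam := by
    refine mul_lt_of_lt_one_left hlam ?_
    rw [div_lt_one hξ1]
    linarith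
  rw [lassoObjective_eq_penalizedLoss] at hθhat
  have hmin := hθhat (exists_isMinOn_penalizedLoss hv hgrad hz0 hz1)
  -- For empty T the factor is +∞ and its real value carries no information; there the minimizer is
  -- exactly 0.
  rcases (supp θs).eq_empty_or_nonempty with hT0 | hT1
  · have hθ0 : θs = 0 := by
      ext p
      by_contra hp
      have : p ∈ supp θs := by
        simp only [supp, Finset.mem_filter, Finset.mem_univ, true_and]
        exact hp
      rw [hT0] at this
      exact absurd this (Finset.notMem_empty p)
    subst hθ0
    have h0 := eq_zero_of_isMinOn hv hgrad hz1 hlam.le hmin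
    rw [h0, hT0, thresholdSupp]
    simp [hδ.le]
  · obtain ⟨hF, hr0, hr, hsmall, hE1, hE2⟩ := hT hT1
    have hα := two_lt_alpha hξ
    set Fr := (trueFactor ξ θs).toReal with hFr
    have hΦ : 0 < Fr * ((alpha ξ - 2) / alpha ξ) :=
      mul_pos hF (div_pos (by linarith) (by linarith))
    have hsupp : ∀ p ∉ supp θs, θs p = 0 := fun p hp => by
      by_contra h
      exact hp (by simp [supp, h])
    have hnorm := norm_sub_le_of_isMinOn hv hX hξ hgrad hlam hmin hsupp hΦ
      (fun b hb hcone => factor_mul_le_tiltedVariance hv hX hξ hF hr hr0 hE1 hE2 hb hcone) hsmall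
    refine thresholdSupp_eq_of_norm_sub_le (hnorm.trans ?_) hδ hδ_lt
    have hFeq : trueFactor ξ θs = ENNReal.ofReal Fr :=
      (ENNReal.ofReal_toReal (trueFactor_ne_top hξ hT1)).symm
    rw [errorBound, hFeq, ← ENNReal.ofReal_div_of_pos hF, ENNReal.ofReal_le_ofReal_iff hδ.le]
      at hδ_ge
    refine le_trans (le_of_eq ?_) hδ_ge
    have h1 : alpha ξ ≠ 0 := by linarith
    have h2 : alpha ξ - 2 ≠ 0 := by linarith
    have h3 := hF.ne'
    field_simp

end Selection

/-! ### Union bound and sample-size conditions. -/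

section UnionBound

variable {Ω : Type*} [MeasurableSpace Ω] {μ : Measure Ω}

theorem measureReal_iUnion_le_card_mul {α : Type*} [Fintype α] {A : α → Set Ω} {c : ℝ}
    (h : ∀ a, μ.real (A a) ≤ c) : μ.real (⋃ a, A a) ≤ Fintype.card α * c := by
  refine (measureReal_iUnion_fintype_le A).trans ((Finset.sum_le_sum fun a _ => h a).trans ?_)
  rw [Finset.sum_const, nsmul_eq_mul, Finset.card_univ]

/-- A (possibly nonmeasurable) set that contains almost all of the complement of `B`. -/
theorem one_sub_le_measureReal_of_ae [IsProbabilityMeasure μ] {A B : Set Ω} {c : ℝ} (hB : μ.real B ≤ c)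
    (h : ∀ᵐ ω ∂μ, ω ∉ B → ω ∈ A) : 1 - c ≤ μ.real A := by
  have h1 : μ.real Bᶜ ≤ μ.real A :=
    ENNReal.toReal_mono (measure_ne_top _ _) (measure_mono_ae h)
  have h2 : μ.real Set.univ ≤ μ.real B + μ.real Bᶜ := by
    rw [← Set.union_compl_self B]
    exact measureReal_union_le _ _
  rw [probReal_univ] at h2
  linarith

end UnionBound

section SampleSize

theorem le_mul_sq_of_ofReal_div_le {x Fr : ℝ} {N : ℕ} (hF : 0 < Fr)
    (h : ENNReal.ofReal x / ENNReal.ofReal Fr ^ 2 ≤ (N : ℝ≥0∞)) : x ≤ N * Fr ^ 2 := by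
  rw [← ENNReal.ofReal_pow hF.le, ← ENNReal.ofReal_div_of_pos (by positivity),
    ← ENNReal.ofReal_natCast, ENNReal.ofReal_le_ofReal_iff (Nat.cast_nonneg N)] at h
  exact (div_le_iff₀ (by positivity)).1 h

/-- A vanishing factor would make the required sample size infinite. -/
theorem toReal_pos_of_ofReal_div_le {x : ℝ} {F : ℝ≥0∞} {N : ℕ} (hx : 0 < x) (hF : F ≠ ⊤)
    (h : ENNReal.ofReal x / F ^ 2 ≤ (N : ℝ≥0∞)) : 0 < F.toReal := by
  refine ENNReal.toReal_pos (fun h0 => ?_) hF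
  rw [h0, zero_pow two_ne_zero, ENNReal.div_zero (ENNReal.ofReal_pos.2 hx).ne'] at h
  exact (ENNReal.natCast_ne_top N) (top_le_iff.1 h)

end SampleSize

end IsingLasso

/-! ### Assembly: probabilities of the bad events and constants. -/

theorem corollary1
    {Ω : Type*} [MeasurableSpace Ω] (μ : Measure Ω) [IsProbabilityMeasure μ]
    (d n m : ℕ) (hn : 0 < n) (hm : 0 < m)
    -- the true parameter, the parameter of the Gibbs sampler, the initial density of the chain
    (θs ψ : Param d) (q : Config d → ℝ)
    (hq_nonneg : ∀ y, 0 ≤ q y) (hq_sum : ∑ y, q y = 1)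
    -- the i.i.d. sample from the Ising model
    (Y : Fin n → Ω → Config d) (hY_meas : ∀ i, Measurable (Y i)) (hY_indep : iIndepFun Y μ)
    (hY_law : ∀ i y, μ.real {ω | Y i ω = y} = isingDensity θs y)
    -- the Markov chain sample
    (Z : ℕ → Ω → Config d) (hZ : IsMarkovChain μ q (gibbsMatrix ψ) m Z)
    (ε ξ δ : ℝ) (hε : 0 < ε) (hξ : 1 < ξ) (hδ : 0 < δ)
    (b1 b2 M lam : ℝ) (F : ℝ≥0∞)
    (hb1 : b1 = beta1 q (isingDensity ψ)) (hb2 : b2 = beta2 ψ)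
    (hM : M = maxRatio θs (isingDensity ψ))
    (hlam : lam = smoothing d n m ξ ε b1 b2 M)
    (hF : F = trueFactor ξ θs)
    -- the sample size conditions
    (hncond : ENNReal.ofReal (8 * (1 + ξ) ^ 4 * alpha ξ ^ 2 * ((supp θs).card : ℝ) ^ 2 *
        Real.log (2 * numParam d / ε)) / F ^ 2 ≤ (n : ℝ≥0∞))
    (hmcond : ENNReal.ofReal (64 * (1 + ξ) ^ 4 * alpha ξ ^ 2 * ((supp θs).card : ℝ) ^ 2 * M ^ 2 *
        Real.log (2 * numParam d * (numParam d + 1) * b1 / ε) / b2) / F ^ 2 ≤ (m : ℝ≥0∞))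
    -- the Lasso estimator: a minimizer of the objective, wherever there is one
    (θhat : Ω → Param d)
    (hθhat : ∀ᵐ ω ∂μ,
      (∃ θ, IsMinOn (lassoObjective m (isingDensity ψ) lam (fun i => Y i ω) (fun k => Z k ω))
        Set.univ θ) →
      IsMinOn (lassoObjective m (isingDensity ψ) lam (fun i => Y i ω) (fun k => Z k ω))
        Set.univ (θhat ω))
    -- the threshold
    (hδ_lt : ENNReal.ofReal δ < thetaMin θs / 2)
    (hδ_ge : errorBound ξ lam F ≤ ENNReal.ofReal δ) :
    1 - 4 * ε ≤ μ.real {ω | thresholdSupp δ (θhat ω) = supp θs} := by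
  rcases isEmpty_or_nonempty (Pair d) with hP | hP
  · have : {ω | thresholdSupp δ (θhat ω) = supp θs} = Set.univ :=
      Set.eq_univ_of_forall fun ω => Subsingleton.elim _ _
    rw [this, probReal_univ]
    linarith
  -- For ε ≥ 1/4 the claim is trivial; below, all logarithms are positive.
  rcases le_or_gt (1 / 4) ε with hε4 | hε4
  · exact le_trans (by linarith) measureReal_nonneg
  have hd : 0 < d := (Nat.zero_le _).trans_lt hP.some.1.1.isLt
  set D : ℝ := numParam d with hD
  have hDcard : D = Fintype.card (Pair d) := numParam_eq_card d
  have hD1 : 1 ≤ D := by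
    rw [hDcard]
    exact_mod_cast Fintype.card_pos
  have hb1' : 1 ≤ b1 := hb1 ▸ one_le_beta1 hq_sum ψ
  have hb2' : 0 < b2 := hb2 ▸ beta2_pos hd ψ
  have hM' : 1 ≤ M := hM ▸ one_le_maxRatio θs ψ
  have hn' : (0 : ℝ) < n := Nat.cast_pos.2 hn
  have hm' : (0 : ℝ) < m := Nat.cast_pos.2 hm
  have hα := two_lt_alpha hξ
  set L1 := Real.log (2 * D / ε) with hL1
  set L2 := Real.log ((2 * D + 1) * b1 / ε) with hL2
  set L3 := Real.log (2 * D * (D + 1) * b1 / ε) with hL3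
  have hL1pos : 0 < L1 := Real.log_pos (by rw [one_lt_div hε]; linarith)
  have hL2pos : 0 < L2 := Real.log_pos (by rw [one_lt_div hε]; nlinarith)
  have hL23 : L2 ≤ L3 := by
    refine Real.log_le_log (by positivity) ?_
    gcongr
    nlinarith
  have hL3pos : 0 < L3 := hL2pos.trans_le hL23
  -- The radii at which the tail exponents equal the three logarithms: data means, Monte Carlo first
  -- moments, second moments.
  set t1 := √(2 * L1 / n) with ht1
  set t2 := 4 * M * √(L2 / (m * b2)) with ht2
  set t3 := 4 * M * √(L3 / (m * b2)) with ht3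
  have hM0 : 0 < M := by linarith
  have ht1pos : 0 < t1 := Real.sqrt_pos.2 (by positivity)
  have ht2pos : 0 < t2 := mul_pos (by positivity) (Real.sqrt_pos.2 (by positivity))
  have ht3pos : 0 < t3 := mul_pos (by positivity) (Real.sqrt_pos.2 (by positivity))
  have ht23 : t2 ≤ t3 := by
    refine mul_le_mul_of_nonneg_left (Real.sqrt_le_sqrt ?_) (by positivity)
    gcongr
  have ht1sq : n * t1 ^ 2 / 2 = L1 := by
    rw [ht1, Real.sq_sqrt (by positivity)]
    field_simp
  have htsq : ∀ L : ℝ, 0 < L →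
      b2 * m * (4 * M * √(L / (m * b2))) ^ 2 / (16 * M ^ 2) = L := fun L hL => by
    rw [mul_pow, Real.sq_sqrt (by positivity)]
    field_simp
    norm_num
  have hlam' : lam = (ξ + 1) / (ξ - 1) * max (2 * t1) (2 * t2) := by
    rw [hlam, smoothing]
    congr 2
    rw [ht2]
    ring
  have hξ1 : 0 < ξ - 1 := by linarith
  have hξ2 : 0 < ξ + 1 := by linarith
  have hlampos : 0 < lam := by
    rw [hlam']
    exact mul_pos (div_pos hξ2 hξ1) (lt_max_of_lt_left (by positivity))
  have hz : (ξ - 1) / (ξ + 1) * lam = max (2 * t1) (2 * t2) := by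
    rw [hlam']
    field_simp
  -- the events on which an average is far from its mean
  set EA : Set Ω := ⋃ p, {ω | t1 < |sampleMean (fun i => Y i ω) p -
    isingMean θs fun y => J y p|} with hEA
  set EB : Set Ω := ⋃ p, {ω | t2 < |chainMean m ψ (fun k => Z k ω) θs (fun y => J y p) -
    isingMean θs fun y => J y p|} with hEB
  set EC : Set Ω := ⋃ pp : Pair d × Pair d, {ω | t3 <
    |chainMean m ψ (fun k => Z k ω) θs (fun y => J y pp.1 * J y pp.2) -
      isingMean θs fun y => J y pp.1 * J y pp.2|} with hEC
  have hJJ : ∀ (p p' : Pair d) (y : Config d), |J y p * J y p'| ≤ 1 := fun p p' y => by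
    rw [abs_mul, abs_J, abs_J, one_mul]
  have hA : μ.real EA ≤ ε := by
    have h1 := measureReal_iUnion_le_card_mul (μ := μ) fun p =>
      measureReal_abs_sampleMean_sub_gt_le hn hY_meas hY_indep hY_law p ht1pos.le
    refine h1.trans (le_of_eq ?_)
    rw [ht1sq, ← hDcard, Real.exp_neg, hL1, Real.exp_log (by positivity)]
    field_simp
  have hB : μ.real EB ≤ ε := by
    have h1 := measureReal_iUnion_le_card_mul (μ := μ) fun p : Pair d =>
      measureReal_abs_chainMean_sub_gt_le hd hm hq_nonneg hZ (θ := θs) (g := fun y => J y p)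
        (fun y => (abs_J y p).le) ht2pos
    refine h1.trans ?_
    rw [← hb1, ← hb2, ← hM, ht2, htsq L2 hL2pos, ← hDcard, Real.exp_neg, hL2,
      Real.exp_log (by positivity)]
    have e : D * (2 * (b1 * ((2 * D + 1) * b1 / ε)⁻¹)) = 2 * D / (2 * D + 1) * ε := by
      field_simp
    rw [e]
    refine mul_le_of_le_one_left hε.le ?_
    rw [div_le_one (by positivity)]
    linarith
  have hC : μ.real EC ≤ ε := by
    have h1 := measureReal_iUnion_le_card_mul (μ := μ) fun pp : Pair d × Pair d =>
      measureReal_abs_chainMean_sub_gt_le hd hm hq_nonneg hZ (θ := θs)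
        (g := fun y => J y pp.1 * J y pp.2) (hJJ pp.1 pp.2) ht3pos
    refine h1.trans ?_
    rw [← hb1, ← hb2, ← hM, ht3, htsq L3 hL3pos, Fintype.card_prod, Nat.cast_mul, ← hDcard,
      Real.exp_neg, hL3, Real.exp_log (by positivity)]
    have e : D * D * (2 * (b1 * (2 * D * (D + 1) * b1 / ε)⁻¹)) = D / (D + 1) * ε := by
      field_simp
    rw [e]
    refine mul_le_of_le_one_left hε.le ?_
    rw [div_le_one (by positivity)]
    linarith
  have hbad : μ.real (EA ∪ EB ∪ EC) ≤ 4 * ε := by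
    have h1 := measureReal_union_le (μ := μ) (EA ∪ EB) EC
    have h2 := measureReal_union_le (μ := μ) EA EB
    linarith
  refine one_sub_le_measureReal_of_ae hbad ?_
  filter_upwards [hθhat] with ω hω hgood
  simp only [hEA, hEB, hEC, Set.mem_union, Set.mem_iUnion, Set.mem_ofPred_eq, not_or, not_exists,
    not_lt, Prod.forall] at hgood
  obtain ⟨⟨gA, gB⟩, gC⟩ := hgood
  subst hF
  refine thresholdSupp_eq_supp (r := t3) hm hξ hδ hlampos hω (fun p => ?_) hδ_lt hδ_ge fun hT => ?_
  · rw [hz]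
    have h1 := abs_sub_le (chainMean m ψ (fun k => Z k ω) θs fun y => J y p)
      (isingMean θs fun y => J y p) (sampleMean (fun i => Y i ω) p)
    rw [abs_sub_comm (isingMean θs fun y => J y p)] at h1
    have h2 := le_max_left (2 * t1) (2 * t2)
    have h3 := le_max_right (2 * t1) (2 * t2)
    linarith [gA p, gB p]
  · set s : ℝ := ((supp θs).card : ℝ) with hs
    have hs0 : 0 < s := Nat.cast_pos.2 hT.card_pos
    have hFtop := trueFactor_ne_top hξ hT
    have hFpos : 0 < (trueFactor ξ θs).toReal :=
      toReal_pos_of_ofReal_div_le (by positivity) hFtop hncond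
    rw [← ENNReal.ofReal_toReal hFtop] at hncond hmcond
    have hnc := le_mul_sq_of_ofReal_div_le hFpos hncond
    have hmc := le_mul_sq_of_ofReal_div_le hFpos hmcond
    set Fr := (trueFactor ξ θs).toReal with hFr
    -- The sample-size conditions amount to 2·t1 ≤ Q and 2·t3 ≤ Q.
    set Q := Fr / (alpha ξ * (1 + ξ) ^ 2 * s) with hQ
    have hα0 : 0 < alpha ξ := by linarith
    have hξ3 : 0 < 1 + ξ := by linarith
    have hQ0 : 0 < Q := by positivity
    have ht1Q : 2 * t1 ≤ Q := by
      rw [← le_div_iff₀' two_pos]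
      refine (Real.sqrt_le_left (by positivity)).2 ?_
      rw [hQ, div_pow, div_pow, mul_pow, mul_pow, div_div, div_le_div_iff₀ hn' (by positivity)]
      linarith
    have ht3Q : 2 * t3 ≤ Q := by
      have h1 : √(L3 / (m * b2)) ≤ Q / (8 * M) := by
        refine (Real.sqrt_le_left (by positivity)).2 ?_
        rw [div_le_iff₀ hb2'] at hmc
        rw [hQ, div_pow, div_pow, mul_pow, mul_pow, mul_pow, div_div,
          div_le_div_iff₀ (by positivity) (by positivity)]
        linarith
      rw [le_div_iff₀ (by positivity)] at h1
      rw [ht3]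
      linarith
    refine ⟨hFpos, ht3pos.le, ?_, ?_, fun p => (gB p).trans ht23, gC⟩
    -- There is room here: 3·t3 ≤ 3Q/2 while 2Q is allowed.
    · have h1 : 2 / alpha ξ * Fr = 2 * Q * ((1 + ξ) ^ 2 * s) := by
        rw [hQ]
        field_simp
      rw [h1]
      refine mul_le_mul_of_nonneg_right ?_ (by positivity)
      linarith
    · have h1 : lam ≤ (ξ + 1) / (ξ - 1) * Q := by
        rw [hlam']
        refine mul_le_mul_of_nonneg_left (max_le ht1Q (by linarith)) (by positivity)
      -- The choice of α makes this an identity: α - 2 = e/(ξ-1) cancels the factor 1/e from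
      -- self-concordance.
      have h2 : Real.exp (-1) * (Fr * ((alpha ξ - 2) / alpha ξ)) =
          (ξ + 1) / (ξ - 1) * Q * (ξ + 1) * s := by
        have h3 : alpha ξ - 2 = Real.exp 1 / (ξ - 1) := by
          rw [alpha]
          ring
        have h4 : Real.exp (-1) * Real.exp 1 = 1 := by
          rw [← Real.exp_add, neg_add_cancel, Real.exp_zero]
        calc Real.exp (-1) * (Fr * ((alpha ξ - 2) / alpha ξ))
            = (Real.exp (-1) * Real.exp 1) * (Fr / ((ξ - 1) * alpha ξ)) := by
              rw [h3]
              field_simp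
          _ = _ := by
              rw [h4, hQ]
              field_simp
              ring
      rw [h2]
      gcongr
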